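/- Let $N\ge 1$, and let $0=k_1<k_2<\dots<k_N$ and $l_1<l_2<\dots<l_N$ be integers with $l_N\le N-1$. Let $\alpha_1,\dots,\alpha_N,\beta_1,\dots,\beta_N$ be complex numbers with $|\alpha_j|<1$, $0<|\beta_j|<1$, the $\beta_j$ pairwise distinct. **Model.** Consider $N$ walkers with integer heights $x^{(s)}_i$ on the lines $s=0,1,\dots,2N$, with $x_i^{(0)}=k_i$, $x_i^{(2N)}=l_i$. In step $n$ (from line $n-1$ to line $n$) every walker makes a vertical jump of size $m\ge 0$ on the line $s=n-\frac12$, upwards with weight $\alpha_n^m$ if $1\le n\le N$, downwards with weight $\beta_{2N-n+1}^m$ if $N+1\le n\le 2N$. The weight $w$ of a family of paths is the product of the weights of all its jumps. A family is nonintersecting if the trajectories are disjoint, that is, if for each $n$ the vertical segments between $x_i^{(n-1)}$ and $x_i^{(n)}$, $i=1,\dots,N$, are pairwise disjoint. Let $Z$ be the sum of $w$ over all nonintersecting families and, for distinct points $(s_1,x_1),\dots,(s_n,x_n)\in\{0,\dots,2N\}\times\mathbb Z$, let $\rho((s_1,x_1),\dots,(s_n,x_n))$ be $Z^{-1}$ times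 the sum of $w$ over the nonintersecting families that pass through all these points. (For $0\le\alpha_j<1$, $0<\beta_j<1$ this is the probability that the paths, conditioned never to intersect, pass through these points.) **Notation.** For $\gamma\in\mathbb C^N$ (with nonzero entries where an exponent is negative) let $h_k(\gamma)=\det(\gamma_j^{k_i})_{i,j=1}^N$ and $h_l(\gamma)=\det(\gamma_j^{l_i})_{i,j=1}^N$; let $(\beta;\beta_j\mapsto z)$ be $\beta$ with $\beta_j$ replaced by $z$, and $(1/\beta;1/\beta_j\mapsto 1/z)$ be $(1/\beta_1,\dots,1/\beta_N)$ with $1/\beta_j$ replaced by $1/z$. Let $F_\ell(z)=(1-\alpha_\ell z)^{-1}$ for $1\le\ell\le N$ and $F_\ell(z)=(1-\beta_{2N-\ell+1}/z)^{-1}$ for $N+1\le\ell\le 2N$. All contour integrals below are over the positively oriented unit circle $\partial\mathbb D$. **Theorem.** The weights of the nonintersecting families are absolutely summable. Assume $Z\ne0$. Then for all $n\ge 0$ and all distinct points $(s_1,x_1),\dots,(s_n,x_n)\in\{0,\dots,2N\}\times\mathbb Z$, $$\rho((s_1,x_1),\dots,(s_n,x_n))=\det\big(K(s_i,x_i;s_j,x_j)\big)_{i,j=1}^n,$$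 where $$K(s_1,x_1;s_2,x_2)=-\mathbb 1_{s_1>s_2}\frac1{2\pi i}\oint_{\partial\mathbb D}\prod_{j=s_2+1}^{s_1}F_j(z)\frac{dz}{z^{x_1-x_2+1}} +\sum_{j=1}^N\frac{\prod_{r=1}^N(1-\alpha_r\beta_j)\prod_{s\ne j}(1-\beta_s/\beta_j)}{h_k(\beta)\,h_l(1/\beta)}$$ $$\times\Big(\frac1{2\pi i}\oint_{\partial\mathbb D}h_k(\beta;\beta_j\mapsto z)\prod_{\ell=1}^{s_1}F_\ell(z)\frac{dz}{z^{x_1+1}}\Big)\Big(\frac1{2\pi i}\oint_{\partial\mathbb D}h_l(1/\beta;1/\beta_j\mapsto1/z)\prod_{\ell=s_2+1}^{2N}F_\ell(z)\frac{z^{x_2}dz}{z}\Big).$$ Moreover, for integers $0\le s_1,s_2\le N$ and $x_1,x_2\ge 0$ the kernel does not depend on the $l_j$: $$K(s_1,x_1;s_2,x_2)=-\mathbb 1_{s_1>s_2}\frac1{2\pi i}\oint_{\partial\mathbb D}\prod_{j=s_2+1}^{s_1}(1-\alpha_jz)^{-1}\frac{dz}{z^{x_1-x_2+1}}$$ $$+\sum_{j=1}^N\frac1{2\pi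 i}\oint_{\partial\mathbb D}\frac{h_k(\beta;\beta_j\mapsto z)}{h_k(\beta)}\prod_{r=1}^{s_2}(1-\alpha_r\beta_j)\,\beta_j^{x_2}\prod_{\ell=1}^{s_1}(1-\alpha_\ell z)^{-1}\frac{dz}{z^{x_1+1}}.$$ If all $\alpha_j$ are real in $[0,1)$ and all $\beta_j$ are real in $(0,1)$, then $Z\neq0$, the law of the paths conditioned never to intersect is a probability measure, and it is a determinantal point process with kernel $K$: the probability that the paths pass through distinct points $(s_1,x_1),\dots,(s_n,x_n)$ is $\det(K(s_i,x_i;s_j,x_j))_{i,j=1}^n$. -/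

import Mathlib

open MeasureTheory

namespace StaircasePaths

noncomputable section

/-- The alternant `h_{k_1,…,k_N}(γ) = det (γ_j ^ k_i)`. -/
def alternant {N : ℕ} (k : Fin N → ℤ) (γ : Fin N → ℂ) : ℂ :=
  (Matrix.of fun i j : Fin N => γ j ^ k i).det

/-- The parameter of the `n`-th vertical jump. Indices are counted from zero, so with `n + 1` in
place of `n` this is `α_n` for the first `N` jumps and `β_{2N-n+1}` for the last `N` jumps. -/
def stepParam {R : Type*} {N : ℕ} (α β : Fin N → R) (n : Fin (2 * N)) : R :=
  if h : n.val < N then α ⟨n.val, h⟩ else β ⟨2 * N - 1 - n.val, by omega⟩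

/-- The generating function of the jump weights of the `n`-th step (counted from zero). -/
def stepGen {N : ℕ} (α β : Fin N → ℂ) (n : Fin (2 * N)) (z : ℂ) : ℂ :=
  if n.val < N then (1 - stepParam α β n * z)⁻¹ else (1 - stepParam α β n / z)⁻¹

/-! ### The paths -/

/-- Heights of `N` walkers on the `2 N + 1` lines: `X s i` is the height of walker `i` on the
line with (shifted) abscissa `s ∈ {0, …, 2N}`. The walker moves from `X n i` to `X (n + 1) i` by a
vertical jump on the line with abscissa `n + 1/2`. -/
abbrev PathTuple (N : ℕ) : Type := Fin (2 * N + 1) → Fin N → ℤ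

/-- The walkers start at `k`, end at `l`, jump upwards in the first `N` steps and downwards in the
last `N` steps (jumps of size zero are allowed). -/
def IsWalk {N : ℕ} (k l : Fin N → ℤ) (X : PathTuple N) : Prop :=
  (∀ i, X 0 i = k i) ∧ (∀ i, X (Fin.last (2 * N)) i = l i) ∧
    ∀ (n : Fin (2 * N)) (i : Fin N),
      if n.val < N then X n.castSucc i ≤ X n.succ i else X n.succ i ≤ X n.castSucc i

/-- The trajectories do not meet: on every line that carries vertical jumps, the vertical
segments of different walkers are disjoint. The ends of these segments are the heights of the
horizontal pieces before and after the jump, so these do not meet either. -/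
def Nonintersecting {N : ℕ} (X : PathTuple N) : Prop :=
  ∀ (n : Fin (2 * N)) (i j : Fin N), i ≠ j →
    Disjoint (Set.uIcc (X n.castSucc i) (X n.succ i)) (Set.uIcc (X n.castSucc j) (X n.succ j))

/-- Each jump of size `m` in step `n` contributes the factor `(stepParam α β n) ^ m`. -/
def weight {R : Type*} [CommMonoid R] {N : ℕ} (α β : Fin N → R) (X : PathTuple N) : R :=
  ∏ n : Fin (2 * N), ∏ i : Fin N, stepParam α β n ^ (X n.succ i - X n.castSucc i).natAbs

/-- The nonintersecting path families from `k` to `l`. -/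
def configs {N : ℕ} (k l : Fin N → ℤ) : Set (PathTuple N) :=
  {X | IsWalk k l X ∧ Nonintersecting X}

/-- The points in which the paths meet the lines `s = 0, …, 2N`. -/
def points {N : ℕ} (X : PathTuple N) : Set (Fin (2 * N + 1) × ℤ) :=
  {q | ∃ i, X q.1 i = q.2}

/-- The total weight of all nonintersecting path families from `k` to `l`. -/
def partitionFunction {N : ℕ} (k l : Fin N → ℤ) (α β : Fin N → ℂ) : ℂ :=
  ∑' X : configs k l, weight α β X.1

/-- The correlation function: the normalized total weight of the nonintersecting path families
that pass through all of the given points. -/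
def correlation {N : ℕ} (k l : Fin N → ℤ) (α β : Fin N → ℂ) {n : ℕ}
    (p : Fin n → Fin (2 * N + 1) × ℤ) : ℂ :=
  (∑' X : {X : PathTuple N | X ∈ configs k l ∧ ∀ m, p m ∈ points X}, weight α β X.1) /
    partitionFunction k l α β

/-- For nonnegative parameters: the measure that gives each family of walks from `k` to `l`,
intersecting or not, its weight. -/
def walkMeasure {N : ℕ} (k l : Fin N → ℤ) (a b : Fin N → ℝ) : Measure (PathTuple N) :=
  Measure.sum fun X : {X : PathTuple N // IsWalk k l X} =>
    ENNReal.ofReal (weight a b X.1) • Measure.dirac X.1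

/-- The law of the paths, conditioned never to intersect. -/
def pathLaw {N : ℕ} (k l : Fin N → ℤ) (a b : Fin N → ℝ) : Measure (PathTuple N) :=
  ProbabilityTheory.cond (walkMeasure k l a b) {X | Nonintersecting X}

/-! ### The kernels -/

/-- `(2πi)⁻¹ ∮ f(z) dz` over the positively oriented unit circle. -/
def contour (f : ℂ → ℂ) : ℂ :=
  (2 * (Real.pi : ℂ) * Complex.I)⁻¹ * ∮ z in C(0, 1), f z

/-- The kernel for arbitrary lines `s₁, s₂ ∈ {0, …, 2N}`. -/
def kernel {N : ℕ} (k l : Fin N → ℤ) (α β : Fin N → ℂ) (s₁ : ℕ) (x₁ : ℤ) (s₂ : ℕ) (x₂ : ℤ) : ℂ :=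
  -(if s₂ < s₁ then
      contour fun z =>
        (∏ n : Fin (2 * N) with s₂ ≤ n.val ∧ n.val < s₁, stepGen α β n z) / z ^ (x₁ - x₂ + 1)
    else 0) +
  ∑ j : Fin N,
    (((∏ r : Fin N, (1 - α r * β j)) * ∏ s ∈ Finset.univ.erase j, (1 - β s / β j)) /
      (alternant k β * alternant l (fun i => 1 / β i))) *
    (contour fun z =>
      alternant k (Function.update β j z) *
        (∏ n : Fin (2 * N) with n.val < s₁, stepGen α β n z) / z ^ (x₁ + 1)) *
    (contour fun z =>
      alternant l (Function.update (fun i => 1 / β i) j (1 / z)) *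
        (∏ n : Fin (2 * N) with s₂ ≤ n.val, stepGen α β n z) * (z ^ x₂ / z))

/-- The simpler kernel for lines `s₁, s₂ ∈ {0, …, N}`; it does not involve the end points. -/
def leftKernel {N : ℕ} (k : Fin N → ℤ) (α β : Fin N → ℂ)
    (s₁ : ℕ) (x₁ : ℤ) (s₂ : ℕ) (x₂ : ℤ) : ℂ :=
  -(if s₂ < s₁ then
      contour fun z =>
        (∏ n : Fin N with s₂ ≤ n.val ∧ n.val < s₁, (1 - α n * z)⁻¹) / z ^ (x₁ - x₂ + 1)
    else 0) +
  ∑ j : Fin N,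
    contour fun z =>
      (alternant k (Function.update β j z) / alternant k β) *
        (∏ r : Fin N with r.val < s₂, (1 - α r * β j)) * β j ^ x₂ *
        (∏ n : Fin N with n.val < s₁, (1 - α n * z)⁻¹) / z ^ (x₁ + 1)

end

end StaircasePaths

/-!
The weight of a single step of all walkers is a determinant: for increasing `x` and `y`, the
determinant of the single-walker jump weights from `x i` to `y j` vanishes unless the step is
admissible, and otherwise is its weight (`det_jump`). Hence the sum over nonintersecting families is
a sum of products of determinants over increasing tuples, and the Cauchy–Binet formula for infinite
matrices (`hasSum_det_mul_det`) turns it into a single determinant of sums over the paths of one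
walker. The latter, `propagator`, are Laurent coefficients of products of the functions `stepGen`;
in particular the partition function is the determinant of `gramMatrix`. Absolute summability at
each step follows from the geometric decay of the jump weights.

For the correlation functions, every point `p m` is given the weight `1 + t m`. The single-walker
sums with these weights have a closed form (`pathSum`): they solve a linear system whose matrix
`1 - W T` has determinant one, because paths run from left to right. Consequently the weighted
partition function is `det G * det (1 + T M)` with `G` the Gram matrix, `T` the diagonal matrix of
the `t m`, and `M = B G⁻¹ A - W` (`det_weighted`). Inclusion–exclusion over `t m ∈ {0, 1}` extracts
on the one side the families through all the points, on the other side `det M`.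

It remains to identify `M` with the kernel. Since `k i ≥ 0` and `l j ≤ N - 1`, the integrand for
`G i j` has no pole at the origin, and the residues at the points `β r` (`propagator_to_end`) factor
`G` as the alternant matrix of `k`, times a diagonal matrix, times the transposed alternant matrix
of `l`. This inverts `G`, and by Cramer's rule the adjugates of the alternant matrices, applied to
the propagators, are the contour integrals of alternants with one argument replaced by `z`. The same
residue computation on the left half eliminates the end points.

For nonnegative parameters the partition function is positive since there is a family of positive
weight (`exists_mem_configs_weight_pos`), and the probability in question is the correlation
function.
-/

namespace StaircasePaths

/-! ### Infinite sums over tuples -/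

theorem summable_prod_pi {β : Type*} {n : ℕ} (f : Fin n → β → ℝ) (h0 : ∀ i b, 0 ≤ f i b)
    (hf : ∀ i, Summable (f i)) : Summable fun x : Fin n → β => ∏ i, f i (x i) := by
  induction n with
  | zero => exact (hasSum_fintype _).summable
  | succ n ih =>
    rw [← (Fin.consEquiv fun _ => β).summable_iff]
    have h := (hf 0).mul_of_nonneg (ih (fun i => f i.succ) (fun i => h0 i.succ) fun i => hf i.succ)
      (h0 0) fun x => Finset.prod_nonneg fun i _ => h0 _ _
    refine h.congr fun z => ?_
    simp [Fin.prod_univ_succ, Fin.consEquiv]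

theorem summable_norm_prod_pi {β : Type*} {n : ℕ} (f : Fin n → β → ℂ)
    (hf : ∀ i, Summable fun b => ‖f i b‖) :
    Summable fun x : Fin n → β => ‖∏ i, f i (x i)‖ := by
  simp_rw [norm_prod]
  exact summable_prod_pi (fun i b => ‖f i b‖) (fun _ _ => norm_nonneg _) hf

theorem hasSum_of_forall_eq {ι R : Type*} [AddCommMonoid R] [TopologicalSpace R] {f g : ι → R}
    {a : R} (h : HasSum f a) (e : ∀ x, g x = f x) : HasSum g a := by
  rwa [show g = f from funext e]

theorem hasSum_prod_pi {β : Type*} {n : ℕ}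
    (f : Fin n → β → ℂ) (hf : ∀ i, Summable fun b => ‖f i b‖) :
    HasSum (fun x : Fin n → β => ∏ i, f i (x i)) (∏ i, ∑' b, f i b) := by
  induction n with
  | zero => simp [hasSum_unique]
  | succ n ih =>
    rw [Fin.prod_univ_succ]
    refine (Equiv.hasSum_iff (Fin.consEquiv fun _ : Fin (n + 1) => β)).1 ?_
    have h0 : HasSum (f 0) (∑' b, f 0 b) := (hf 0).of_norm.hasSum
    have h1 := ih (fun i => f i.succ) fun i => hf i.succ
    have hn := summable_norm_prod_pi (fun i => f i.succ) fun i => hf i.succ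
    generalize hg : (fun x : Fin n → β => ∏ i : Fin n, f i.succ (x i)) = g at h1
    have hn' : Summable fun x => ‖g x‖ := by rw [← hg]; exact hn
    have hs : Summable fun z : β × (Fin n → β) => f 0 z.1 * g z.2 :=
      summable_mul_of_summable_norm (hf 0) hn'
    have h := h0.mul h1 hs
    subst hg
    refine hasSum_of_forall_eq h fun z => ?_
    simp [Fin.prod_univ_succ, Fin.consEquiv]

/-- Summing out one line at a time: for kernels `T n` with absolutely summable rows, the sum over
all sequences of states started at `x` of the product of the kernels, weighted by a bounded
function `h` of the final state, is obtained by applying the kernels to `h` successively. -/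
theorem hasSum_paths {S : Type*} {C : ℝ} {M : ℕ} (T : Fin M → S → S → ℂ)
    (hT : ∀ n x, Summable fun y => ‖T n x y‖) (hTC : ∀ n x, ∑' y, ‖T n x y‖ ≤ C)
    (V : Fin (M + 1) → S → ℂ) (D : ℝ) (hD : ∀ x, ‖V (Fin.last M) x‖ ≤ D)
    (hV : ∀ (n : Fin M) x, HasSum (fun y => T n x y * V n.succ y) (V n.castSucc x)) (x : S) :
    HasSum (fun Y : Fin M → S => (∏ n : Fin M,
        T n ((Fin.cons x Y : Fin (M + 1) → S) n.castSucc) ((Fin.cons x Y : Fin (M + 1) → S) n.succ))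
        * V (Fin.last M) ((Fin.cons x Y : Fin (M + 1) → S) (Fin.last M))) (V 0 x) := by
  -- The induction carries a bound for the sum of the absolute values, uniform in `x`.
  have hC : 0 ≤ C ∨ M = 0 := by
    rcases M with _ | M
    · exact Or.inr rfl
    · exact Or.inl ((tsum_nonneg fun _ => norm_nonneg _).trans (hTC 0 x))
  suffices H : ∀ x, (HasSum (fun Y : Fin M → S => (∏ n : Fin M,
        T n ((Fin.cons x Y : Fin (M + 1) → S) n.castSucc) ((Fin.cons x Y : Fin (M + 1) → S) n.succ))
        * V (Fin.last M) ((Fin.cons x Y : Fin (M + 1) → S) (Fin.last M))) (V 0 x)) ∧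
      (Summable fun Y : Fin M → S => ‖(∏ n : Fin M,
        T n ((Fin.cons x Y : Fin (M + 1) → S) n.castSucc) ((Fin.cons x Y : Fin (M + 1) → S) n.succ))
        * V (Fin.last M) ((Fin.cons x Y : Fin (M + 1) → S) (Fin.last M))‖) ∧
      (∑' Y : Fin M → S, ‖(∏ n : Fin M,
        T n ((Fin.cons x Y : Fin (M + 1) → S) n.castSucc) ((Fin.cons x Y : Fin (M + 1) → S) n.succ))
        * V (Fin.last M) ((Fin.cons x Y : Fin (M + 1) → S) (Fin.last M))‖) ≤ C ^ M * D from
    (H x).1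
  clear x
  induction M with
  | zero =>
    intro x
    refine ⟨?_, (hasSum_fintype _).summable, ?_⟩
    · simp [hasSum_unique]
    · simpa using hD x
  | succ M ih =>
    have hC : 0 ≤ C := by simpa using hC
    intro x
    set G : S → (Fin M → S) → ℂ := fun y Y => (∏ n : Fin M,
        T n.succ ((Fin.cons y Y : Fin (M + 1) → S) n.castSucc)
          ((Fin.cons y Y : Fin (M + 1) → S) n.succ))
        * V (Fin.last (M + 1)) ((Fin.cons y Y : Fin (M + 1) → S) (Fin.last M)) with hG
    have hi := fun y => ih (fun n => T n.succ) (fun n => hT n.succ) (fun n => hTC n.succ)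
      (fun n => V n.succ) hD (fun n => hV n.succ) (Or.inl hC) y
    have key : ∀ z : S × (Fin M → S), (∏ n : Fin (M + 1),
        T n ((Fin.cons x (Fin.consEquiv (fun _ => S) z) : Fin (M + 2) → S) n.castSucc)
          ((Fin.cons x (Fin.consEquiv (fun _ => S) z) : Fin (M + 2) → S) n.succ))
        * V (Fin.last (M + 1))
          ((Fin.cons x (Fin.consEquiv (fun _ => S) z) : Fin (M + 2) → S) (Fin.last (M + 1)))
        = T 0 x z.1 * G z.1 z.2 := by
      intro z
      rw [hG, Fin.prod_univ_succ, ← Fin.succ_last]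
      simp only [Fin.castSucc_zero, Fin.cons_zero, Fin.cons_succ, Fin.consEquiv, Equiv.coe_fn_mk,
        ← Fin.succ_castSucc, mul_assoc]
    have hb : ∀ y, ∑' Y, ‖T 0 x y * G y Y‖ ≤ ‖T 0 x y‖ * (C ^ M * D) := by
      intro y
      simp_rw [norm_mul, tsum_mul_left]
      exact mul_le_mul_of_nonneg_left (hi y).2.2 (norm_nonneg _)
    have hfib : ∀ y, Summable fun Y => ‖T 0 x y * G y Y‖ := by
      intro y
      simp_rw [norm_mul]
      exact (hi y).2.1.mul_left _
    have hout : Summable fun y => ∑' Y, ‖T 0 x y * G y Y‖ :=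
      Summable.of_nonneg_of_le (fun y => tsum_nonneg fun _ => norm_nonneg _) hb
        ((hT 0 x).mul_right _)
    have hsum : Summable fun z : S × (Fin M → S) => ‖T 0 x z.1 * G z.1 z.2‖ :=
      (summable_prod_of_nonneg fun _ => norm_nonneg _).2 ⟨hfib, hout⟩
    have hhas : HasSum (fun z : S × (Fin M → S) => T 0 x z.1 * G z.1 z.2) (V 0 x) := by
      have h1 := hsum.of_norm.hasSum.prod_fiberwise fun y => (hi y).1.mul_left (T 0 x y)
      have h2 := h1.unique (hV 0 x)
      rw [Fin.castSucc_zero] at h2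
      rw [← h2]
      exact hsum.of_norm.hasSum
    refine ⟨?_, ?_, ?_⟩
    · rw [← (Fin.consEquiv fun _ => S).hasSum_iff]
      exact hasSum_of_forall_eq hhas key
    · rw [← (Fin.consEquiv fun _ => S).summable_iff]
      refine hsum.congr fun z => ?_
      exact congrArg norm (key z).symm
    · rw [← (Fin.consEquiv fun _ => S).tsum_eq]
      simp_rw [key]
      rw [hsum.tsum_prod]
      refine (Summable.tsum_le_tsum hb hout ((hT 0 x).mul_right _)).trans ?_
      rw [tsum_mul_right, pow_succ', mul_assoc]
      have hD0 : 0 ≤ D := (norm_nonneg _).trans (hD x)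
      exact mul_le_mul_of_nonneg_right (hTC 0 x) (by positivity)

/-! ### The Cauchy–Binet formula -/

/-- Strictly increasing tuples of integers: the possible heights of the walkers on a line. -/
abbrev Heights (N : ℕ) : Type := {x : Fin N → ℤ // StrictMono x}

/-- Every injective tuple is, in exactly one way, a permutation of a strictly increasing one. -/
theorem heights_perm_injective (N : ℕ) :
    Function.Injective fun q : Heights N × Equiv.Perm (Fin N) => q.1.1 ∘ q.2 := by
  rintro ⟨⟨x, hx⟩, σ⟩ ⟨⟨y, hy⟩, τ⟩ h
  have h' : x ∘ σ = y ∘ τ := h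
  have hr : Set.range x = Set.range y := by
    rw [← σ.surjective.range_comp x, h', τ.surjective.range_comp y]
  have hxy : x = y := (StrictMono.range_inj hx hy).1 hr
  subst hxy
  have : σ = τ := Equiv.ext fun i => hx.injective (congrFun h' i)
  subst this
  rfl

theorem mem_range_heights_perm {N : ℕ} {x : Fin N → ℤ} (hx : Function.Injective x) :
    x ∈ Set.range fun q : Heights N × Equiv.Perm (Fin N) => q.1.1 ∘ q.2 := by
  refine ⟨(⟨x ∘ Tuple.sort x, (Tuple.monotone_sort x).strictMono_of_injective
    (hx.comp (Tuple.sort x).injective)⟩, (Tuple.sort x)⁻¹), ?_⟩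
  ext i
  simp

/-- The Cauchy–Binet formula for infinite matrices. -/
theorem hasSum_det_mul_det {N : ℕ} (a b : Fin N → ℤ → ℂ) (c : Matrix (Fin N) (Fin N) ℂ)
    (hs : ∀ i j, Summable fun x => ‖a i x * b j x‖)
    (hc : ∀ i j, HasSum (fun x => a i x * b j x) (c i j)) :
    HasSum (fun x : Heights N => (Matrix.of fun i j => a i (x.1 j)).det *
      (Matrix.of fun i j => b j (x.1 i)).det) c.det := by
  have h1 : HasSum (fun x : Fin N → ℤ =>
      (∏ i, a i (x i)) * (Matrix.of fun i j => b j (x i)).det) c.det := by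
    have h := hasSum_sum (s := Finset.univ) fun (σ : Equiv.Perm (Fin N)) _ =>
      (hasSum_prod_pi (fun i x => a i x * b (σ i) x) fun i => hs i (σ i)).mul_left
        ((Equiv.Perm.sign σ : ℤ) : ℂ)
    simp_rw [(hc _ _).tsum_eq] at h
    rw [← Matrix.det_transpose, Matrix.det_apply']
    refine hasSum_of_forall_eq h fun x => ?_
    rw [← Matrix.det_transpose, Matrix.det_apply', Finset.mul_sum]
    refine Finset.sum_congr rfl fun σ _ => ?_
    simp only [Matrix.transpose_apply, Matrix.of_apply, Finset.prod_mul_distrib]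
    ring
  have h2 := (heights_perm_injective N).hasSum_iff (f := fun x : Fin N → ℤ =>
      (∏ i, a i (x i)) * (Matrix.of fun i j => b j (x i)).det) (a := c.det) fun x hx => by
    have hx' : ¬ Function.Injective x := fun h => hx (mem_range_heights_perm h)
    simp only [Function.Injective, not_forall] at hx'
    obtain ⟨i, j, hij, hne⟩ := hx'
    rw [Matrix.det_zero_of_row_eq hne, mul_zero]
    ext k
    simp [hij]
  have h3 := (h2.2 h1).prod_fiberwise fun x => hasSum_fintype _
  refine hasSum_of_forall_eq h3 fun x => ?_
  rw [← Matrix.det_transpose, Matrix.det_apply', Finset.sum_mul]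
  refine Finset.sum_congr rfl fun σ _ => ?_
  have := Matrix.det_permute σ (Matrix.of fun i j => b j (x.1 i))
  simp only [Matrix.transpose_apply, Matrix.of_apply, Function.comp_apply] at this ⊢
  rw [show (Matrix.of fun i j => b j (x.1 (σ i))) =
    (Matrix.of fun i j => b j (x.1 i)).submatrix σ id from rfl, this]
  ring

/-! ### One step: the determinant detects disjointness -/

/-- The weight of a jump by `d` for a walker that may only jump upwards. -/
noncomputable def upJump (γ : ℂ) (d : ℤ) : ℂ := if 0 ≤ d then γ ^ d.natAbs else 0

theorem upJump_of_nonneg {γ : ℂ} {d : ℤ} (h : 0 ≤ d) : upJump γ d = γ ^ d.natAbs := if_pos h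

theorem upJump_of_neg {γ : ℂ} {d : ℤ} (h : d < 0) : upJump γ d = 0 := if_neg (not_le.2 h)

theorem upJump_add {γ : ℂ} {d e : ℤ} (hd : 0 ≤ d) (he : 0 ≤ e) :
    upJump γ (d + e) = upJump γ d * upJump γ e := by
  rw [upJump_of_nonneg hd, upJump_of_nonneg he, upJump_of_nonneg (by omega), ← pow_add]
  congr 1
  omega

/-- A permutation that matches an increasing sequence with larger terms of another increasing
sequence can be replaced by the identity. -/
theorem le_of_perm_le {N : ℕ} {x y : Fin N → ℤ} (hx : StrictMono x) (hy : StrictMono y)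
    (σ : Equiv.Perm (Fin N)) (h : ∀ i, x (σ i) ≤ y i) (i : Fin N) : x i ≤ y i := by
  by_contra! hlt
  have hmaps : ∀ a ∈ Finset.Iic i, σ a ∈ Finset.Iio i := by
    intro a ha
    rw [Finset.mem_Iic] at ha
    rw [Finset.mem_Iio]
    by_contra! hle
    have h1 := hx.monotone hle
    have h2 := hy.monotone ha
    have h3 := h a
    omega
  have := Finset.card_le_card_of_injOn σ hmaps σ.injective.injOn
  simp at this

/-- The Lindström–Gessel–Viennot determinant for a single upward step: it is the weight of the step
if the segments are disjoint, and zero otherwise. -/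
theorem det_upJump {N : ℕ} {x y : Fin N → ℤ} (hx : StrictMono x) (hy : StrictMono y) (γ : ℂ) :
    (Matrix.of fun i j => upJump γ (y j - x i)).det =
      if (∀ i, x i ≤ y i) ∧ ∀ i j, i < j → y i < x j then
        ∏ i, γ ^ (y i - x i).natAbs else 0 := by
  split_ifs with h
  · rw [Matrix.det_of_isUpperTriangular]
    · exact Finset.prod_congr rfl fun i _ => upJump_of_nonneg (by linarith [h.1 i])
    · intro i j hij
      exact upJump_of_neg (by linarith [h.2 j i hij])
  by_cases h1 : ∀ i, x i ≤ y i
  · -- Take the first walker `i` whose segment reaches the next walker: then the rows of `i` and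
    -- of that walker are proportional.
    have h2 : (Finset.univ.filter fun i => ∃ j, i < j ∧ x j ≤ y i).Nonempty := by
      simp only [h1, implies_true, true_and, not_forall, not_lt] at h
      obtain ⟨i, j, hij, hle⟩ := h
      exact ⟨i, by simpa using ⟨j, hij, hle⟩⟩
    obtain ⟨i, hi, hmin⟩ := Finset.exists_minimal h2
    simp only [Finset.mem_filter, Finset.mem_univ, true_and] at hi hmin
    obtain ⟨j, hij, hle⟩ := hi
    -- Subtracting `γ ^ (x j - x i)` times row `j` kills row `i`: in the columns `b < i` both rows
    -- vanish by the choice of `i`, and in the other columns `x j ≤ y b`.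
    rw [← Matrix.det_updateRow_add_smul_self _ hij.ne (-(upJump γ (x j - x i)))]
    refine Matrix.det_eq_zero_of_row_eq_zero i fun b => ?_
    simp only [Matrix.updateRow_self, Pi.add_apply, Pi.smul_apply, Matrix.of_apply, smul_eq_mul]
    rcases lt_or_ge b i with hb | hb
    · have hbi : y b < x i := by
        by_contra! hc
        exact absurd (hmin ⟨i, hb, hc⟩ hb.le) (not_le.2 hb)
      have hxij := hx hij
      rw [upJump_of_neg (by omega), upJump_of_neg (d := y b - x j) (by omega)]
      ring
    · have hyb := hy.monotone hb
      have hxij := hx hij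
      rw [show y b - x i = (x j - x i) + (y b - x j) by ring,
        upJump_add (by omega) (by omega)]
      ring
  · -- No permutation matches all starting heights with larger final heights.
    rw [Matrix.det_apply]
    refine Finset.sum_eq_zero fun σ _ => ?_
    by_cases h2 : ∀ i, x (σ i) ≤ y i
    · exact absurd (le_of_perm_le hx hy σ h2) h1
    · push Not at h2
      obtain ⟨i, hi⟩ := h2
      rw [Finset.prod_eq_zero (Finset.mem_univ i), smul_zero]
      exact upJump_of_neg (by omega)

theorem det_downJump {N : ℕ} {x y : Fin N → ℤ} (hx : StrictMono x) (hy : StrictMono y) (γ : ℂ) :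
    (Matrix.of fun i j => upJump γ (-(y j - x i))).det =
      if (∀ i, y i ≤ x i) ∧ ∀ i j, i < j → x i < y j then
        ∏ i, γ ^ (y i - x i).natAbs else 0 := by
  rw [← Matrix.det_transpose]
  convert det_upJump hy hx γ using 2
  · ext i j
    simp
  · refine Finset.prod_congr rfl fun i _ => ?_
    congr 1
    omega

/-- With parameter zero the determinant tests equality. -/
theorem det_upJump_zero {N : ℕ} {x y : Fin N → ℤ} (hx : StrictMono x) (hy : StrictMono y) :
    (Matrix.of fun i j => upJump 0 (y j - x i)).det = if x = y then 1 else 0 := by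
  rw [det_upJump hx hy]
  by_cases hxy : x = y
  · subst hxy
    simp only [le_refl, implies_true, true_and, sub_self, Int.natAbs_zero, pow_zero,
      Finset.prod_const_one, if_true]
    exact if_pos fun i j hij => hx hij
  · rw [if_neg hxy]
    split_ifs with h
    · obtain ⟨i, hi⟩ := Function.ne_iff.1 hxy
      refine Finset.prod_eq_zero (Finset.mem_univ i) (zero_pow ?_)
      omega
    · rfl

section Steps

variable {N : ℕ}

/-- The weight of a jump by `d` in the `n`-th step (counted from zero). -/
noncomputable def jump (α β : Fin N → ℂ) (n : Fin (2 * N)) (d : ℤ) : ℂ :=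
  upJump (stepParam α β n) (if n.val < N then d else -d)

/-- The conditions of `IsWalk` and `Nonintersecting` on the `n`-th step, from `x` to `y`. -/
def Admissible (n : Fin (2 * N)) (x y : Fin N → ℤ) : Prop :=
  (∀ i, if n.val < N then x i ≤ y i else y i ≤ x i) ∧
    ∀ i j, i ≠ j → Disjoint (Set.uIcc (x i) (y i)) (Set.uIcc (x j) (y j))

theorem Admissible.strictMono {n : Fin (2 * N)} {x y : Fin N → ℤ} (h : Admissible n x y)
    (hx : StrictMono x) : StrictMono y := by
  intro i j hij
  have hd := Set.disjoint_left.1 (h.2 i j hij.ne)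
  have h1 := h.1 i
  have h2 := h.1 j
  have hxij := hx hij
  by_contra! hc
  split_ifs at h1 h2 with hn
  · exact hd (a := x j) (Set.mem_uIcc.2 (by omega)) (Set.mem_uIcc.2 (by omega))
  · exact hd (a := x i) (Set.mem_uIcc.2 (by omega)) (Set.mem_uIcc.2 (by omega))

theorem disjoint_uIcc_iff {a b c d : ℤ} :
    Disjoint (Set.uIcc a b) (Set.uIcc c d) ↔
      (a < c ∧ a < d ∧ b < c ∧ b < d) ∨ (c < a ∧ d < a ∧ c < b ∧ d < b) := by
  constructor
  · intro h
    rw [Set.disjoint_left] at h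
    have h1 := fun e => @h e
    simp only [Set.mem_uIcc] at h1
    have := h1 a
    have := h1 b
    have := h1 c
    have := h1 d
    omega
  · intro h
    rw [Set.disjoint_left]
    intro e
    simp only [Set.mem_uIcc]
    omega

/-- The determinant of the single-walker jump weights is the weight of the step if it is
admissible, and zero otherwise. -/
theorem det_jump {x y : Fin N → ℤ} (hx : StrictMono x) (hy : StrictMono y)
    (α β : Fin N → ℂ) (n : Fin (2 * N)) [Decidable (Admissible n x y)] :
    (Matrix.of fun i j => jump α β n (y j - x i)).det =
      if Admissible n x y then ∏ i, stepParam α β n ^ (y i - x i).natAbs else 0 := by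
  unfold jump
  by_cases hn : n.val < N
  · simp only [hn, if_true]
    rw [det_upJump hx hy]
    congr 1
    rw [eq_iff_iff, Admissible]
    simp only [hn, if_true]
    refine and_congr_right fun h => ⟨fun h2 i j hij => ?_, fun h2 i j hij => ?_⟩
    · rw [disjoint_uIcc_iff]
      have hi := h i
      have hj := h j
      rcases lt_or_gt_of_ne hij with hlt | hlt
      · have := h2 i j hlt
        omega
      · have := h2 j i hlt
        omega
    · have hd := disjoint_uIcc_iff.1 (h2 i j hij.ne)
      have := hx hij
      omega
  · simp only [hn, if_false]
    rw [det_downJump hx hy]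
    congr 1
    rw [eq_iff_iff, Admissible]
    simp only [hn, if_false]
    refine and_congr_right fun h => ⟨fun h2 i j hij => ?_, fun h2 i j hij => ?_⟩
    · rw [disjoint_uIcc_iff]
      have hi := h i
      have hj := h j
      rcases lt_or_gt_of_ne hij with hlt | hlt
      · have := h2 i j hlt
        omega
      · have := h2 j i hlt
        omega
    · have hd := disjoint_uIcc_iff.1 (h2 i j hij.ne)
      have := hx hij
      omega

end Steps

/-! ### Contour integrals over the unit circle -/

theorem contour_congr {f g : ℂ → ℂ} (h : ∀ z : ℂ, ‖z‖ = 1 → f z = g z) : contour f = contour g := by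
  unfold contour
  congr 1
  exact circleIntegral.integral_congr zero_le_one fun z hz => h z (by simpa using hz)

theorem contour_const_mul (c : ℂ) (f : ℂ → ℂ) : contour (fun z => c * f z) = c * contour f := by
  unfold contour
  rw [circleIntegral.integral_const_mul]
  ring

theorem circleIntegrable_of_continuousOn {f : ℂ → ℂ} (h : ContinuousOn f {z | ‖z‖ = 1}) :
    CircleIntegrable f 0 1 :=
  ContinuousOn.circleIntegrable zero_le_one (h.mono fun z hz => by simpa using hz)

theorem contour_sum {ι : Type*} (s : Finset ι) (f : ι → ℂ → ℂ)
    (h : ∀ i ∈ s, ContinuousOn (f i) {z | ‖z‖ = 1}) :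
    contour (fun z => ∑ i ∈ s, f i z) = ∑ i ∈ s, contour (f i) := by
  unfold contour
  rw [circleIntegral.integral_fun_sum fun i hi => circleIntegrable_of_continuousOn (h i hi),
    Finset.mul_sum]

theorem norm_contour_le {f : ℂ → ℂ} {C : ℝ} (h : ∀ z : ℂ, ‖z‖ = 1 → ‖f z‖ ≤ C) :
    ‖contour f‖ ≤ C := by
  have := circleIntegral.norm_two_pi_i_inv_smul_integral_le_of_norm_le_const (c := 0) (f := f) (C := C)
    zero_le_one fun z hz => h z (by simpa using hz)
  simpa [contour] using this

theorem ne_zero_of_norm_eq_one {z : ℂ} (hz : ‖z‖ = 1) : z ≠ 0 := by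
  rintro rfl
  simp at hz

theorem continuousOn_zpow_circle (x : ℤ) : ContinuousOn (fun z : ℂ => z ^ x) {z | ‖z‖ = 1} :=
  fun z hz => (continuousAt_zpow₀ z x (Or.inl (ne_zero_of_norm_eq_one hz))).continuousWithinAt

theorem continuousOn_div_zpow_circle {f : ℂ → ℂ} (h : ContinuousOn f {z | ‖z‖ = 1}) (x : ℤ) :
    ContinuousOn (fun z => f z / z ^ x) {z | ‖z‖ = 1} :=
  h.div (continuousOn_zpow_circle x) fun _ hz => zpow_ne_zero _ (ne_zero_of_norm_eq_one hz)

theorem contour_one_div_zpow (x : ℤ) :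
    contour (fun z => 1 / z ^ (x + 1)) = if x = 0 then 1 else 0 := by
  have hpi : (2 * (Real.pi : ℂ) * Complex.I) ≠ 0 := by simp [Real.pi_ne_zero]
  unfold contour
  split_ifs with h
  · subst h
    have := circleIntegral.integral_sub_center_inv (0 : ℂ) (R := 1) one_ne_zero
    simp only [sub_zero] at this
    simp only [zero_add, zpow_one, one_div, this]
    exact inv_mul_cancel₀ hpi
  · have := circleIntegral.integral_sub_zpow_of_ne (n := -(x + 1)) (by omega) 0 0 1
    simp only [sub_zero, zpow_neg] at this
    simp [this]

/-- Multiplying the integrand by an absolutely convergent Laurent series amounts to a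
convolution with its coefficients. -/
theorem hasSum_contour {a : ℤ → ℂ} {A g : ℂ → ℂ} (ha : Summable fun d => ‖a d‖)
    (hA : ∀ z : ℂ, ‖z‖ = 1 → HasSum (fun d => a d * z ^ d) (A z))
    (hg : ContinuousOn g {z | ‖z‖ = 1}) (w : ℤ) :
    HasSum (fun d => a d * contour fun z => g z / z ^ (w - d + 1))
      (contour fun z => A z * g z / z ^ (w + 1)) := by
  simp_rw [← contour_const_mul]
  unfold contour circleIntegral
  refine HasSum.mul_left _ ?_
  have hcirc : ∀ θ : ℝ, ‖circleMap 0 1 θ‖ = 1 := fun θ => by simp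
  have hcm : Continuous fun θ : ℝ => circleMap 0 1 θ := continuous_circleMap 0 1
  obtain ⟨C, hC⟩ := (isCompact_sphere (0 : ℂ) 1).exists_bound_of_continuousOn
    (hg.mono fun z hz => by simpa using hz)
  have hC' : ∀ θ : ℝ, ‖g (circleMap 0 1 θ)‖ ≤ C := fun θ => hC _ (by simp)
  refine intervalIntegral.hasSum_integral_of_dominated_convergence (fun d _ => ‖a d‖ * C)
    (fun d => ?_) (fun d => ?_) ?_ ?_ ?_
  · refine Continuous.aestronglyMeasurable ?_
    simp only [deriv_circleMap]
    refine (hcm.mul continuous_const).smul (continuous_const.mul ?_)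
    exact (continuousOn_div_zpow_circle hg _).comp_continuous hcm hcirc
  · refine Filter.Eventually.of_forall fun θ _ => ?_
    simp only [deriv_circleMap, norm_smul, norm_mul, norm_div, norm_zpow, hcirc, Complex.norm_I,
      one_zpow, mul_one, div_one, one_mul]
    exact mul_le_mul_of_nonneg_left (hC' θ) (norm_nonneg _)
  · exact Filter.Eventually.of_forall fun θ _ => ha.mul_right C
  · exact intervalIntegrable_const
  · refine Filter.Eventually.of_forall fun θ _ => ?_
    have h := ((hA _ (hcirc θ)).mul_right (g (circleMap 0 1 θ) / circleMap 0 1 θ ^ (w + 1))).const_smul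
      (deriv (circleMap 0 1) θ)
    have h0 := ne_zero_of_norm_eq_one (hcirc θ)
    rw [← mul_div_assoc] at h
    refine hasSum_of_forall_eq h fun d => ?_
    dsimp only
    congr 1
    rw [show w - d + 1 = (w + 1) - d by ring, zpow_sub₀ h0]
    field_simp

theorem summable_norm_upJump {γ : ℂ} (h : ‖γ‖ < 1) : Summable fun d => ‖upJump γ d‖ := by
  rw [← (Nat.cast_injective (R := ℤ)).summable_iff]
  · refine (summable_geometric_of_lt_one (norm_nonneg γ) h).congr fun n => ?_
    simp [upJump]
  · intro d hd
    rw [upJump_of_neg, norm_zero]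
    by_contra! hc
    exact hd ⟨d.toNat, by simpa using hc⟩

theorem hasSum_upJump {γ z : ℂ} (h : ‖γ‖ < 1) (hz : ‖z‖ = 1) :
    HasSum (fun d => upJump γ d * z ^ d) (1 - γ * z)⁻¹ := by
  rw [← (Nat.cast_injective (R := ℤ)).hasSum_iff]
  · refine hasSum_of_forall_eq (hasSum_geometric_of_norm_lt_one (ξ := γ * z) (by simp [hz, h]))
      fun n => ?_
    simp [upJump, mul_pow]
  · intro d hd
    rw [upJump_of_neg, zero_mul]
    by_contra! hc
    exact hd ⟨d.toNat, by simpa using hc⟩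

section Propagator

variable {N : ℕ}

theorem norm_stepParam_lt {α β : Fin N → ℂ} (hα : ∀ j, ‖α j‖ < 1) (hβ : ∀ j, ‖β j‖ < 1)
    (n : Fin (2 * N)) : ‖stepParam α β n‖ < 1 := by
  unfold stepParam
  split_ifs
  · exact hα _
  · exact hβ _

theorem summable_norm_jump {α β : Fin N → ℂ} (hα : ∀ j, ‖α j‖ < 1) (hβ : ∀ j, ‖β j‖ < 1)
    (n : Fin (2 * N)) : Summable fun d => ‖jump α β n d‖ := by
  have h := summable_norm_upJump (norm_stepParam_lt hα hβ n)
  unfold jump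
  by_cases hn : n.val < N
  · simpa only [hn, if_true] using h
  · simp only [hn, if_false]
    exact (Equiv.neg ℤ).summable_iff (f := fun d => ‖upJump (stepParam α β n) d‖) |>.2 h

theorem hasSum_jump {α β : Fin N → ℂ} (hα : ∀ j, ‖α j‖ < 1) (hβ : ∀ j, ‖β j‖ < 1)
    (n : Fin (2 * N)) {z : ℂ} (hz : ‖z‖ = 1) :
    HasSum (fun d => jump α β n d * z ^ d) (stepGen α β n z) := by
  have hp := norm_stepParam_lt hα hβ n
  unfold jump stepGen
  by_cases hn : n.val < N
  · simpa only [hn, if_true] using hasSum_upJump hp hz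
  · simp only [hn, if_false]
    have h := hasSum_upJump (z := z⁻¹) hp (by simp [hz])
    rw [div_eq_mul_inv]
    refine hasSum_of_forall_eq ((Equiv.neg ℤ).hasSum_iff.2 h) fun d => ?_
    simp

theorem one_sub_mul_ne_zero {γ z : ℂ} (h : ‖γ‖ < 1) (hz : ‖z‖ ≤ 1) : 1 - γ * z ≠ 0 := by
  intro h0
  have h1 : ‖γ * z‖ = 1 := by rw [← sub_eq_zero.1 h0, norm_one]
  rw [norm_mul] at h1
  nlinarith [norm_nonneg γ, norm_nonneg z]

theorem continuousOn_stepGen {α β : Fin N → ℂ} (hα : ∀ j, ‖α j‖ < 1) (hβ : ∀ j, ‖β j‖ < 1)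
    (n : Fin (2 * N)) : ContinuousOn (stepGen α β n) {z | ‖z‖ = 1} := by
  have hp := norm_stepParam_lt hα hβ n
  unfold stepGen
  by_cases hn : n.val < N
  · simp only [hn, if_true]
    exact ContinuousOn.inv₀ (by fun_prop) fun z hz => one_sub_mul_ne_zero hp hz.le
  · simp only [hn, if_false]
    refine ContinuousOn.inv₀ (continuousOn_const.sub (continuousOn_const.div continuousOn_id
      fun z hz => ne_zero_of_norm_eq_one hz)) fun z hz => ?_
    rw [div_eq_mul_inv]
    exact one_sub_mul_ne_zero hp (by rw [norm_inv, hz, inv_one])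

/-- The generating function of the displacement of a single walker between the lines `s` and
`t`. -/
noncomputable def symbol (α β : Fin N → ℂ) (s t : ℕ) (z : ℂ) : ℂ :=
  ∏ n : Fin (2 * N) with s ≤ n.val ∧ n.val < t, stepGen α β n z

/-- The total weight of the paths of a single walker from height `0` on line `s` to height `x` on
line `t`, as the coefficient of `z ^ x` in the generating function. -/
noncomputable def propagator (α β : Fin N → ℂ) (s t : ℕ) (x : ℤ) : ℂ :=
  contour fun z => symbol α β s t z / z ^ (x + 1)

theorem continuousOn_symbol {α β : Fin N → ℂ} (hα : ∀ j, ‖α j‖ < 1) (hβ : ∀ j, ‖β j‖ < 1)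
    (s t : ℕ) : ContinuousOn (symbol α β s t) {z | ‖z‖ = 1} :=
  continuousOn_finsetProd _ fun n _ => continuousOn_stepGen hα hβ n

theorem symbol_step (α β : Fin N → ℂ) (n : Fin (2 * N)) {t : ℕ} (h : n.val < t) (z : ℂ) :
    symbol α β n t z = stepGen α β n z * symbol α β (n + 1) t z := by
  unfold symbol
  rw [← Finset.prod_insert (f := fun m => stepGen α β m z) (by simp)]
  congr 1
  ext m
  simp only [Finset.mem_filter, Finset.mem_univ, true_and, Finset.mem_insert, Fin.ext_iff]
  omega

theorem propagator_self (α β : Fin N → ℂ) (s : ℕ) (x : ℤ) :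
    propagator α β s s x = if x = 0 then 1 else 0 := by
  rw [← contour_one_div_zpow, propagator]
  refine contour_congr fun z _ => ?_
  rw [symbol, Finset.prod_eq_one]
  intro n hn
  simp only [Finset.mem_filter, Finset.mem_univ, true_and] at hn
  omega

theorem norm_propagator_le {α β : Fin N → ℂ} (hα : ∀ j, ‖α j‖ < 1) (hβ : ∀ j, ‖β j‖ < 1)
    (s t : ℕ) : ∃ C, ∀ x, ‖propagator α β s t x‖ ≤ C := by
  obtain ⟨C, hC⟩ := (isCompact_sphere (0 : ℂ) 1).exists_bound_of_continuousOn
    ((continuousOn_symbol hα hβ s t).mono fun z hz => by simpa using hz)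
  refine ⟨C, fun x => norm_contour_le fun z hz => ?_⟩
  simpa [hz] using hC z (by simpa using hz)

/-- The first-step decomposition of the paths of a single walker. -/
theorem hasSum_propagator {α β : Fin N → ℂ} (hα : ∀ j, ‖α j‖ < 1) (hβ : ∀ j, ‖β j‖ < 1)
    (n : Fin (2 * N)) {t : ℕ} (h : n.val < t) (w x : ℤ) :
    HasSum (fun y => jump α β n (y - x) * propagator α β (n + 1) t (w - y))
      (propagator α β n t (w - x)) := by
  have h1 := hasSum_contour (summable_norm_jump hα hβ n) (fun z hz => hasSum_jump hα hβ n hz)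
    (continuousOn_symbol hα hβ (n + 1) t) (w - x)
  simp_rw [← symbol_step α β n h] at h1
  refine hasSum_of_forall_eq ((Equiv.subRight x).hasSum_iff.2 h1) fun y => ?_
  simp only [Function.comp_apply, Equiv.subRight_apply, propagator]
  rw [show w - x - (y - x) = w - y by ring]

end Propagator

/-! ### Path sums with weighted points -/

section WeightedPaths

variable {N : ℕ} {ι : Type*}

/-- Total weights of the paths of a single walker from the point `p m` to the point `p m'` on a
line further to the right. -/
noncomputable def innerMatrix (α β : Fin N → ℂ) (p : ι → Fin (2 * N + 1) × ℤ) : Matrix ι ι ℂ :=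
  Matrix.of fun m m' => if (p m).1 < (p m').1 then
    propagator α β (p m).1 (p m').1 ((p m').2 - (p m).2) else 0

/-- Total weights of the paths of a single walker from `(0, k i)` to `p m`. -/
noncomputable def leftMatrix (α β : Fin N → ℂ) (k : Fin N → ℤ) (p : ι → Fin (2 * N + 1) × ℤ) :
    Matrix (Fin N) ι ℂ :=
  Matrix.of fun i m => propagator α β 0 (p m).1 ((p m).2 - k i)

/-- Total weights of the paths of a single walker from `p m` to `(2N, l j)`. -/
noncomputable def rightMatrix (α β : Fin N → ℂ) (l : Fin N → ℤ) (p : ι → Fin (2 * N + 1) × ℤ) :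
    Matrix ι (Fin N) ℂ :=
  Matrix.of fun m j => propagator α β (p m).1 (2 * N) (l j - (p m).2)

/-- Total weights of the paths of a single walker from `(0, k i)` to `(2N, l j)`. -/
noncomputable def gramMatrix (α β : Fin N → ℂ) (k l : Fin N → ℤ) : Matrix (Fin N) (Fin N) ℂ :=
  Matrix.of fun i j => propagator α β 0 (2 * N) (l j - k i)

variable [Fintype ι]

/-- The weight `1 + t m` at the point `p m`, and `1` elsewhere. -/
def siteWeight (p : ι → Fin (2 * N + 1) × ℤ) (t : ι → ℂ) (s : Fin (2 * N + 1)) (x : ℤ) : ℂ :=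
  1 + ∑ m, if p m = (s, x) then t m else 0

theorem norm_siteWeight_le (p : ι → Fin (2 * N + 1) × ℤ) (t : ι → ℂ) (s : Fin (2 * N + 1)) (x : ℤ) :
    ‖siteWeight p t s x‖ ≤ 1 + ∑ m, ‖t m‖ := by
  refine (norm_add_le _ _).trans ?_
  rw [norm_one]
  refine add_le_add_right ((norm_sum_le _ _).trans (Finset.sum_le_sum fun m _ => ?_)) _
  split_ifs <;> simp

variable {α β : Fin N → ℂ} (l : Fin N → ℤ) (p : ι → Fin (2 * N + 1) × ℤ) (t : ι → ℂ)

/-- The weight of a step of `N` walkers from `x` to `y`, with the site weights at `y`. -/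
noncomputable def stepKernel (α β : Fin N → ℂ) (p : ι → Fin (2 * N + 1) × ℤ) (t : ι → ℂ)
    (n : Fin (2 * N)) (x y : Heights N) : ℂ :=
  (Matrix.of fun i j => jump α β n (y.1 j - x.1 i)).det * ∏ i, siteWeight p t n.succ (y.1 i)

theorem norm_stepKernel_le (n : Fin (2 * N)) (x y : Heights N) :
    ‖stepKernel α β p t n x y‖ ≤
      (∏ i, ‖jump α β n (y.1 i - x.1 i)‖) * (1 + ∑ m, ‖t m‖) ^ N := by
  classical
  rw [stepKernel, norm_mul]
  refine mul_le_mul ?_ ?_ (norm_nonneg _) (Finset.prod_nonneg fun _ _ => norm_nonneg _)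
  · rw [det_jump x.2 y.2]
    split_ifs with h
    · rw [norm_prod]
      refine le_of_eq (Finset.prod_congr rfl fun i _ => ?_)
      have hi := h.1 i
      unfold jump
      split_ifs at hi ⊢
      · rw [upJump_of_nonneg (by omega)]
      · rw [upJump_of_nonneg (by omega), Int.natAbs_neg]
    · rw [norm_zero]
      exact Finset.prod_nonneg fun _ _ => norm_nonneg _
  · rw [norm_prod]
    refine (Finset.prod_le_prod (fun _ _ => norm_nonneg _)
      fun i _ => norm_siteWeight_le p t _ _).trans ?_
    simp

theorem summable_stepKernel_bound (hα : ∀ j, ‖α j‖ < 1) (hβ : ∀ j, ‖β j‖ < 1) (n : Fin (2 * N)) :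
    Summable fun d : Fin N → ℤ => (∏ i, ‖jump α β n (d i)‖) * (1 + ∑ m, ‖t m‖) ^ N :=
  (summable_prod_pi (fun _ d => ‖jump α β n d‖) (fun _ _ => norm_nonneg _)
    fun _ => summable_norm_jump hα hβ n).mul_right _

theorem stepKernel_shift_injective (x : Heights N) :
    Function.Injective fun y : Heights N => fun i => y.1 i - x.1 i := by
  intro y y' h
  ext i
  simpa using congrFun h i

theorem summable_norm_stepKernel (hα : ∀ j, ‖α j‖ < 1) (hβ : ∀ j, ‖β j‖ < 1) (n : Fin (2 * N))
    (x : Heights N) : Summable fun y => ‖stepKernel α β p t n x y‖ :=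
  Summable.of_nonneg_of_le (fun _ => norm_nonneg _) (norm_stepKernel_le p t n x)
    ((summable_stepKernel_bound t hα hβ n).comp_injective (stepKernel_shift_injective x))

theorem tsum_norm_stepKernel_le (hα : ∀ j, ‖α j‖ < 1) (hβ : ∀ j, ‖β j‖ < 1) (n : Fin (2 * N))
    (x : Heights N) : ∑' y, ‖stepKernel α β p t n x y‖ ≤
      ∑' d : Fin N → ℤ, (∏ i, ‖jump α β n (d i)‖) * (1 + ∑ m, ‖t m‖) ^ N :=
  Summable.tsum_le_tsum_of_inj _ (stepKernel_shift_injective x)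
    (fun _ _ => mul_nonneg (Finset.prod_nonneg fun _ _ => norm_nonneg _)
      (pow_nonneg (add_nonneg zero_le_one (Finset.sum_nonneg fun _ _ => norm_nonneg _)) _))
    (norm_stepKernel_le p t n x) (summable_norm_stepKernel p t hα hβ n x)
    (summable_stepKernel_bound t hα hβ n)

variable [DecidableEq ι]

/-- Total weights of the paths from `p m` to `(2N, l j)`, with the site weights on the lines to the
right of `p m`: the solution `F` of `F = B + W * diagonal t * F`, where `B` is `rightMatrix` and
`W` is `innerMatrix`. -/
noncomputable def visitMatrix (α β : Fin N → ℂ) (l : Fin N → ℤ) (p : ι → Fin (2 * N + 1) × ℤ)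
    (t : ι → ℂ) : Matrix ι (Fin N) ℂ :=
  (1 - innerMatrix α β p * Matrix.diagonal t)⁻¹ * rightMatrix α β l p

/-- Total weight of the paths from `(s, x)` to `(2N, l j)`, with the site weights on the lines to
the right of `s`. The `m`-th term collects the choice of `t m` from the product of the site weights
`1 + t m` as the first factor different from `1`. -/
noncomputable def pathSum (α β : Fin N → ℂ) (l : Fin N → ℤ) (p : ι → Fin (2 * N + 1) × ℤ)
    (t : ι → ℂ) (s : Fin (2 * N + 1)) (x : ℤ) (j : Fin N) : ℂ :=
  propagator α β s (2 * N) (l j - x) + ∑ m, if s < (p m).1 then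
    propagator α β s (p m).1 ((p m).2 - x) * (t m * visitMatrix α β l p t m j) else 0

variable (α β)

/-- Paths move from left to right, so `innerMatrix` is strictly triangular for the order of the
lines. -/
theorem det_one_sub_innerMatrix_mul_diagonal :
    (1 - innerMatrix α β p * Matrix.diagonal t).det = 1 := by
  have h : (1 - innerMatrix α β p * Matrix.diagonal t).BlockTriangular fun m => (p m).1 := by
    intro m m' h
    have hne : m ≠ m' := by
      rintro rfl
      exact lt_irrefl _ h
    simp [Matrix.one_apply_ne hne, innerMatrix, not_lt.2 h.le]
  rw [h.det_fintype]
  refine Finset.prod_eq_one fun s _ => ?_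
  have h1 : (1 - innerMatrix α β p * Matrix.diagonal t).toSquareBlock (fun m => (p m).1) s = 1 := by
    ext ⟨m, hm⟩ ⟨m', hm'⟩
    have : ¬ (p m).1 < (p m').1 := by rw [hm, hm']; exact lt_irrefl _
    simp [Matrix.toSquareBlock, Matrix.toSquareBlockProp, innerMatrix, this, Matrix.one_apply]
  rw [h1, Matrix.det_one]

theorem visitMatrix_eq : (1 - innerMatrix α β p * Matrix.diagonal t) * visitMatrix α β l p t =
    rightMatrix α β l p := by
  rw [visitMatrix, Matrix.mul_nonsing_inv_cancel_left]
  rw [det_one_sub_innerMatrix_mul_diagonal]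
  exact isUnit_one

theorem pathSum_point (m : ι) (j : Fin N) :
    pathSum α β l p t (p m).1 (p m).2 j = visitMatrix α β l p t m j := by
  have h := congrFun (congrFun (visitMatrix_eq α β l p t) m) j
  rw [Matrix.sub_mul, Matrix.one_mul, Matrix.sub_apply, sub_eq_iff_eq_add, Matrix.mul_assoc,
    Matrix.mul_apply] at h
  rw [h, pathSum]
  congr 1
  refine Finset.sum_congr rfl fun m' _ => ?_
  rw [Matrix.diagonal_mul, innerMatrix, Matrix.of_apply, ite_mul, zero_mul]

/-- The site weight at the starting point turns the strict inequality in `pathSum` into a weak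
one. -/
theorem siteWeight_mul_pathSum (s : Fin (2 * N + 1)) (x : ℤ) (j : Fin N) :
    siteWeight p t s x * pathSum α β l p t s x j =
      propagator α β s (2 * N) (l j - x) + ∑ m, if s ≤ (p m).1 then
        propagator α β s (p m).1 ((p m).2 - x) * (t m * visitMatrix α β l p t m j) else 0 := by
  have h1 : (∑ m, if p m = (s, x) then t m else 0) * pathSum α β l p t s x j =
      ∑ m, if p m = (s, x) then t m * visitMatrix α β l p t m j else 0 := by
    rw [Finset.sum_mul]
    refine Finset.sum_congr rfl fun m _ => ?_
    split_ifs with h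
    · rw [← pathSum_point, h]
    · rw [zero_mul]
  rw [siteWeight, add_mul, h1, one_mul, pathSum, add_assoc, ← Finset.sum_add_distrib]
  congr 1
  refine Finset.sum_congr rfl fun m _ => ?_
  by_cases hs : s = (p m).1
  · subst hs
    rw [if_neg (lt_irrefl _), if_pos le_rfl, propagator_self, zero_add]
    simp only [Prod.ext_iff, true_and, sub_eq_zero, ite_mul, one_mul, zero_mul]
  · have hne : p m ≠ (s, x) := fun h => hs (by rw [h])
    rw [if_neg hne, add_zero]
    simp only [lt_iff_le_and_ne, ne_eq, hs, not_false_eq_true, and_true]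

variable {α β}

theorem norm_pathSum_le (hα : ∀ j, ‖α j‖ < 1) (hβ : ∀ j, ‖β j‖ < 1) (s : Fin (2 * N + 1))
    (j : Fin N) : ∃ C, ∀ x, ‖pathSum α β l p t s x j‖ ≤ C := by
  choose C hC using fun s t => norm_propagator_le hα hβ s t
  refine ⟨C s (2 * N) + ∑ m, ‖(if s < (p m).1 then
    (C s (p m).1 : ℂ) * (t m * visitMatrix α β l p t m j) else 0 : ℂ)‖, fun x => ?_⟩
  unfold pathSum
  refine norm_add_le_of_le (hC _ _ _) (norm_sum_le_of_le Finset.univ fun m _ => ?_)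
  split_ifs
  · rw [norm_mul, norm_mul (C s (p m).1 : ℂ)]
    refine mul_le_mul_of_nonneg_right ?_ (norm_nonneg _)
    rw [Complex.norm_real]
    exact (hC _ _ _).trans (le_abs_self _)
  · rfl

/-- The path sums of a single walker satisfy the first-step recursion. -/
theorem hasSum_pathSum (hα : ∀ j, ‖α j‖ < 1) (hβ : ∀ j, ‖β j‖ < 1) (n : Fin (2 * N)) (x : ℤ)
    (j : Fin N) :
    HasSum (fun y => jump α β n (y - x) *
      (siteWeight p t n.succ y * pathSum α β l p t n.succ y j))
      (pathSum α β l p t n.castSucc x j) := by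
  have h1 := hasSum_propagator hα hβ n n.2 (l j) x
  have h2 : ∀ m, HasSum (fun y => jump α β n (y - x) * (if n.succ ≤ (p m).1 then
      propagator α β (n + 1) (p m).1 ((p m).2 - y) * (t m * visitMatrix α β l p t m j) else 0))
      (if n.castSucc < (p m).1 then
        propagator α β n (p m).1 ((p m).2 - x) * (t m * visitMatrix α β l p t m j) else 0) := by
    intro m
    simp only [← Fin.castSucc_lt_iff_succ_le]
    split_ifs with h
    · simp_rw [← mul_assoc (jump α β n _)]
      exact (hasSum_propagator hα hβ n h _ x).mul_right _
    · simp
  refine hasSum_of_forall_eq (h1.add (hasSum_sum fun m (_ : m ∈ Finset.univ) => h2 m)) fun y => ?_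
  rw [siteWeight_mul_pathSum, mul_add, Finset.mul_sum]
  rfl

theorem summable_norm_jump_mul (hα : ∀ j, ‖α j‖ < 1) (hβ : ∀ j, ‖β j‖ < 1) (n : Fin (2 * N))
    (x : ℤ) (j : Fin N) :
    Summable fun y => ‖jump α β n (y - x) *
      (siteWeight p t n.succ y * pathSum α β l p t n.succ y j)‖ := by
  obtain ⟨C, hC⟩ := norm_pathSum_le l p t hα hβ n.succ j
  refine Summable.of_nonneg_of_le (fun _ => norm_nonneg _) (fun y => ?_)
    (((Equiv.subRight x).summable_iff.2 (summable_norm_jump hα hβ n)).mul_right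
      ((1 + ∑ m, ‖t m‖) * C))
  rw [norm_mul, norm_mul]
  refine mul_le_mul_of_nonneg_left (mul_le_mul (norm_siteWeight_le p t _ _) (hC y)
    (norm_nonneg _) ?_) (norm_nonneg _)
  exact add_nonneg zero_le_one (Finset.sum_nonneg fun _ _ => norm_nonneg _)

/-- One step of the path sum of `N` walkers, by the Cauchy–Binet formula. -/
theorem hasSum_stepKernel (hα : ∀ j, ‖α j‖ < 1) (hβ : ∀ j, ‖β j‖ < 1) (n : Fin (2 * N))
    (x : Heights N) :
    HasSum (fun y : Heights N => stepKernel α β p t n x y *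
      (Matrix.of fun i j => pathSum α β l p t n.succ (y.1 i) j).det)
      (Matrix.of fun i j => pathSum α β l p t n.castSucc (x.1 i) j).det := by
  refine hasSum_of_forall_eq (hasSum_det_mul_det (fun i y => jump α β n (y - x.1 i))
    (fun j y => siteWeight p t n.succ y * pathSum α β l p t n.succ y j) _
    (fun i j => summable_norm_jump_mul l p t hα hβ n (x.1 i) j)
    (fun i j => hasSum_pathSum l p t hα hβ n (x.1 i) j)) fun y => ?_
  have h := Matrix.det_mul_column (fun i => siteWeight p t n.succ (y.1 i))
    (Matrix.of fun i j => pathSum α β l p t n.succ (y.1 i) j)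
  simp only [Matrix.of_apply] at h
  rw [stepKernel, h, mul_assoc]

theorem upJump_zero (d : ℤ) : upJump 0 d = if d = 0 then 1 else 0 := by
  rcases lt_trichotomy d 0 with h | h | h
  · rw [upJump_of_neg h, if_neg h.ne]
  · simp [h, upJump]
  · rw [upJump_of_nonneg h.le, if_neg h.ne', zero_pow (by omega)]

theorem det_pathSum_last (hl : StrictMono l) (x : Heights N) :
    (Matrix.of fun i j => pathSum α β l p t (Fin.last (2 * N)) (x.1 i) j).det =
      if x.1 = l then 1 else 0 := by
  rw [← det_upJump_zero x.2 hl]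
  congr 1
  ext i j
  simp only [Matrix.of_apply, pathSum, not_lt.2 (Fin.le_last _), if_false, Finset.sum_const_zero,
    add_zero, Fin.val_last, propagator_self, upJump_zero]

theorem hasSum_heights_paths (hα : ∀ j, ‖α j‖ < 1) (hβ : ∀ j, ‖β j‖ < 1) (hl : StrictMono l)
    (x : Heights N) :
    HasSum (fun Y : Fin (2 * N) → Heights N => (∏ n : Fin (2 * N), stepKernel α β p t n
        ((Fin.cons x Y : Fin (2 * N + 1) → Heights N) n.castSucc)
        ((Fin.cons x Y : Fin (2 * N + 1) → Heights N) n.succ)) *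
        if ((Fin.cons x Y : Fin (2 * N + 1) → Heights N) (Fin.last (2 * N))).1 = l then 1 else 0)
      (Matrix.of fun i j => pathSum α β l p t 0 (x.1 i) j).det := by
  have h := hasSum_paths (C := ∑ n, ∑' d : Fin N → ℤ,
      (∏ i, ‖jump α β n (d i)‖) * (1 + ∑ m, ‖t m‖) ^ N) (stepKernel α β p t)
    (summable_norm_stepKernel p t hα hβ) (fun n x => ?_)
    (fun s x => (Matrix.of fun i j => pathSum α β l p t s (x.1 i) j).det) 1 (fun x => ?_)
    (hasSum_stepKernel l p t hα hβ) x
  · simpa only [det_pathSum_last l p t hl] using h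
  · refine (tsum_norm_stepKernel_le p t hα hβ n x).trans (Finset.single_le_sum
      (f := fun n => ∑' d : Fin N → ℤ, (∏ i, ‖jump α β n (d i)‖) * (1 + ∑ m, ‖t m‖) ^ N)
      (fun n _ => tsum_nonneg fun _ => ?_) (Finset.mem_univ n))
    exact mul_nonneg (Finset.prod_nonneg fun _ _ => norm_nonneg _)
      (pow_nonneg (add_nonneg zero_le_one (Finset.sum_nonneg fun _ _ => norm_nonneg _)) _)
  · rw [det_pathSum_last l p t hl]
    split_ifs <;> simp

end WeightedPaths

/-! ### From paths to nonintersecting families -/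

section Configurations

variable {N : ℕ} {k l : Fin N → ℤ} {X : PathTuple N}

theorem mem_configs_iff : X ∈ configs k l ↔ X 0 = k ∧ X (Fin.last (2 * N)) = l ∧
    ∀ n : Fin (2 * N), Admissible n (X n.castSucc) (X n.succ) := by
  constructor
  · rintro ⟨⟨h0, h1, h2⟩, h3⟩
    exact ⟨funext h0, funext h1, fun n => ⟨h2 n, h3 n⟩⟩
  · rintro ⟨h0, h1, h2⟩
    exact ⟨⟨congrFun h0, congrFun h1, fun n => (h2 n).1⟩, fun n => (h2 n).2⟩

theorem strictMono_of_mem_configs (hk : StrictMono k) (hX : X ∈ configs k l)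
    (s : Fin (2 * N + 1)) : StrictMono (X s) := by
  rw [mem_configs_iff] at hX
  induction s using Fin.induction with
  | zero => rwa [hX.1]
  | succ n ih => exact (hX.2.2 n).strictMono ih

variable {ι : Type*} [Fintype ι] [DecidableEq ι] {α β : Fin N → ℂ}

/-- The sum over the nonintersecting families, with site weights, is a single determinant. -/
theorem hasSum_configs_siteWeight (hα : ∀ j, ‖α j‖ < 1) (hβ : ∀ j, ‖β j‖ < 1) (hk : StrictMono k)
    (hl : StrictMono l) (p : ι → Fin (2 * N + 1) × ℤ) (t : ι → ℂ) :
    HasSum (fun X : configs k l => weight α β X.1 * ∏ s, ∏ i, siteWeight p t s (X.1 s i))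
      (Matrix.of fun i j => siteWeight p t 0 (k i) * pathSum α β l p t 0 (k i) j).det := by
  classical
  rw [← Function.comp_def (fun X : PathTuple N =>
    weight α β X * ∏ s, ∏ i, siteWeight p t s (X s i)), hasSum_subtype_iff_indicator]
  let lines : (Fin (2 * N) → Heights N) → PathTuple N := fun Y s =>
    ((Fin.cons ⟨k, hk⟩ Y : Fin (2 * N + 1) → Heights N) s).1
  have hinj : Function.Injective lines := by
    intro Y Y' h
    ext n i
    simpa [lines] using congrFun (congrFun h n.succ) i
  -- All lines of a nonintersecting family carry increasing heights, and the first line is `k`.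
  rw [← hinj.hasSum_iff]
  · have h := (hasSum_heights_paths l p t hα hβ hl ⟨k, hk⟩).mul_left
      (∏ i, siteWeight p t 0 (k i))
    have hdet := Matrix.det_mul_column (fun i => siteWeight p t 0 (k i))
      (Matrix.of fun i j => pathSum α β l p t 0 (k i) j)
    simp only [Matrix.of_apply] at hdet
    rw [hdet]
    refine hasSum_of_forall_eq h fun Y => ?_
    have hstep : ∀ n : Fin (2 * N), stepKernel α β p t n
        ((Fin.cons ⟨k, hk⟩ Y : Fin (2 * N + 1) → Heights N) n.castSucc)
        ((Fin.cons ⟨k, hk⟩ Y : Fin (2 * N + 1) → Heights N) n.succ) =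
        (if Admissible n (lines Y n.castSucc) (lines Y n.succ) then
          ∏ i, stepParam α β n ^ (lines Y n.succ i - lines Y n.castSucc i).natAbs else 0) *
          ∏ i, siteWeight p t n.succ (lines Y n.succ i) := by
      intro n
      rw [stepKernel, det_jump (Subtype.prop _) (Subtype.prop _)]
    simp_rw [hstep, Finset.prod_mul_distrib]
    have h0 : lines Y 0 = k := rfl
    have hlast : ((Fin.cons ⟨k, hk⟩ Y : Fin (2 * N + 1) → Heights N) (Fin.last (2 * N))).1 =
      lines Y (Fin.last (2 * N)) := rfl
    rw [hlast]
    by_cases hX : lines Y ∈ configs k l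
    · have hX' := mem_configs_iff.1 hX
      rw [Function.comp_apply, Set.indicator_of_mem hX, Fin.prod_univ_succ, h0, if_pos hX'.2.1,
        Finset.prod_congr rfl fun n _ => if_pos (hX'.2.2 n), weight]
      ring
    · rw [Function.comp_apply, Set.indicator_of_notMem hX]
      rw [mem_configs_iff] at hX
      by_cases hX2 : lines Y (Fin.last (2 * N)) = l
      · have : ∃ n : Fin (2 * N), ¬ Admissible n (lines Y n.castSucc) (lines Y n.succ) := by
          by_contra! hc
          exact hX ⟨h0, hX2, hc⟩
        obtain ⟨n, hn⟩ := this
        rw [Finset.prod_eq_zero (Finset.mem_univ n) (if_neg hn)]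
        ring
      · rw [if_neg hX2]
        ring
  · intro X hX
    refine Set.indicator_of_notMem (fun hmem => hX ?_) _
    refine ⟨fun n => ⟨X n.succ, strictMono_of_mem_configs hk hmem _⟩, ?_⟩
    funext s i
    refine Fin.cases ?_ (fun n => ?_) s
    · simp only [lines, Fin.cons_zero]
      rw [(mem_configs_iff.1 hmem).1]
    · simp [lines]

end Configurations

/-! ### The determinant of the weighted path sums -/

section Determinant

variable {N : ℕ} {ι : Type*} [Fintype ι] [DecidableEq ι] (α β : Fin N → ℂ) (k l : Fin N → ℤ)
  (p : ι → Fin (2 * N + 1) × ℤ) (t : ι → ℂ)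

/-- The transpose of the matrix of the correlation kernel at the points `p`, in terms of the total
weights of the paths of a single walker. -/
noncomputable def correlationMatrix : Matrix ι ι ℂ :=
  rightMatrix α β l p * (gramMatrix α β k l)⁻¹ * leftMatrix α β k p - innerMatrix α β p

theorem siteWeight_mul_pathSum_zero :
    (Matrix.of fun i j => siteWeight p t 0 (k i) * pathSum α β l p t 0 (k i) j) =
      gramMatrix α β k l + leftMatrix α β k p * (Matrix.diagonal t * visitMatrix α β l p t) := by
  ext i j
  rw [Matrix.of_apply, siteWeight_mul_pathSum, Matrix.add_apply, Matrix.mul_apply]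
  simp [gramMatrix, leftMatrix, Matrix.diagonal_mul]

/-- With the site weights `1 + t m`, the partition function is multiplied by a Fredholm
determinant. -/
theorem det_weighted (hG : (gramMatrix α β k l).det ≠ 0) :
    (Matrix.of fun i j => siteWeight p t 0 (k i) * pathSum α β l p t 0 (k i) j).det =
      (gramMatrix α β k l).det *
        (1 + Matrix.diagonal t * correlationMatrix α β k l p).det := by
  set G := gramMatrix α β k l with hGdef
  set A := leftMatrix α β k p with hA
  set B := rightMatrix α β l p with hB
  set W := innerMatrix α β p with hW
  set T := Matrix.diagonal t with hT
  set F := visitMatrix α β l p t with hF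
  have hunit : IsUnit G.det := isUnit_iff_ne_zero.2 hG
  have h1 : (1 - W * T).det = 1 := det_one_sub_innerMatrix_mul_diagonal α β p t
  have h2 : (1 - W * T) * F = B := visitMatrix_eq α β l p t
  calc (Matrix.of fun i j => siteWeight p t 0 (k i) * pathSum α β l p t 0 (k i) j).det
      = (G + A * (T * F)).det := by rw [siteWeight_mul_pathSum_zero]
    _ = (G * (1 + G⁻¹ * A * T * F)).det := by
        rw [Matrix.mul_add, Matrix.mul_one]
        simp only [Matrix.mul_assoc]
        rw [Matrix.mul_nonsing_inv_cancel_left _ _ hunit]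
    _ = G.det * (1 + F * (G⁻¹ * A * T)).det := by
        rw [Matrix.det_mul, Matrix.det_one_add_mul_comm]
    _ = G.det * ((1 - W * T) * (1 + F * (G⁻¹ * A * T))).det := by
        rw [Matrix.det_mul, h1, one_mul]
    _ = G.det * (1 + (B * G⁻¹ * A - W) * T).det := by
        rw [Matrix.mul_add, Matrix.mul_one, ← Matrix.mul_assoc, h2]
        congr 2
        simp only [Matrix.mul_assoc, Matrix.sub_mul]
        abel
    _ = G.det * (1 + T * correlationMatrix α β k l p).det := by
        rw [Matrix.det_one_add_mul_comm]
        rfl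

/-- Inclusion–exclusion for determinants. -/
theorem sum_det_one_add_diagonal_mul {ι : Type*} [Fintype ι] [DecidableEq ι] (M : Matrix ι ι ℂ) :
    ∑ S : Finset ι, (∏ _i ∈ Finset.univ \ S, (-1 : ℂ)) *
      (1 + Matrix.diagonal (fun i => if i ∈ S then 1 else 0) * M).det = M.det := by
  have h := (Matrix.detRowAlternating (n := ι) (R := ℂ)).map_add_univ
    (fun i => (1 + M) i) (fun i => (-1 : Matrix ι ι ℂ) i)
  have h0 : (fun i => (1 + M) i) + (fun i => (-1 : Matrix ι ι ℂ) i) = M := by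
    ext i j
    simp
  rw [h0] at h
  change M.det = _ at h
  rw [h]
  refine Finset.sum_congr rfl fun S _ => ?_
  have h1 : Matrix.of (S.piecewise (fun i => (1 + M) i) fun i => (-1 : Matrix ι ι ℂ) i) =
      Matrix.diagonal (fun i => if i ∈ S then 1 else (-1 : ℂ)) *
        (1 + Matrix.diagonal (fun i => if i ∈ S then 1 else 0) * M) := by
    ext i j
    rw [Matrix.diagonal_mul, Matrix.add_apply, Matrix.diagonal_mul, Matrix.of_apply]
    by_cases hi : i ∈ S <;> simp [hi]
  change _ = (Matrix.of (S.piecewise (fun i => (1 + M) i) fun i => (-1 : Matrix ι ι ℂ) i)).det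
  rw [h1, Matrix.det_mul, Matrix.det_diagonal]
  congr 1
  rw [← Finset.prod_sdiff (Finset.subset_univ S), Finset.prod_congr (s₁ := S) rfl
    fun _ hi => if_pos hi, Finset.prod_const_one, mul_one]
  exact Finset.prod_congr rfl fun _ hi => (if_neg (Finset.mem_sdiff.1 hi).2).symm

theorem prod_one_add_ite {ι : Type*} [Fintype ι] {P : ι → Prop} [DecidablePred P]
    (h : ∀ i j, P i → P j → i = j) (c : ι → ℂ) :
    ∏ i, (1 + if P i then c i else 0) = 1 + ∑ i, if P i then c i else 0 := by
  by_cases hP : ∃ i, P i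
  · obtain ⟨i, hi⟩ := hP
    rw [Fintype.prod_eq_single i, Fintype.sum_eq_single i]
    · exact fun j hj => if_neg fun hPj => hj (h _ _ hPj hi)
    · exact fun j hj => by rw [if_neg fun hPj => hj (h _ _ hPj hi), add_zero]
  · push Not at hP
    simp [hP]

open Classical in
/-- Since the points and the heights on a line are distinct, the product of the site weights over
all positions collects the factor `1 + t m` exactly for the points that are visited. -/
theorem prod_siteWeight {ι : Type*} [Fintype ι] {p : ι → Fin (2 * N + 1) × ℤ} (hp : Function.Injective p) (t : ι → ℂ)
    {X : PathTuple N} (hX : ∀ s, Function.Injective (X s)) :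
    ∏ s, ∏ i, siteWeight p t s (X s i) =
      ∏ m, (1 + t m * if p m ∈ points X then 1 else 0) := by
  have h1 : ∀ s x, siteWeight p t s x = ∏ m, (1 + if p m = (s, x) then t m else 0) :=
    fun s x => (prod_one_add_ite (fun m m' h h' => hp (h.trans h'.symm)) t).symm
  simp_rw [h1]
  rw [← Fintype.prod_prod_type', Finset.prod_comm]
  refine Finset.prod_congr rfl fun m _ => ?_
  have huniq : ∀ a b : Fin (2 * N + 1) × Fin N, p m = (a.1, X a.1 a.2) → p m = (b.1, X b.1 b.2) →
      a = b := by
    rintro ⟨s, i⟩ ⟨s', i'⟩ h h'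
    rw [h, Prod.mk.injEq] at h'
    obtain ⟨rfl, h'⟩ := h'
    exact Prod.ext rfl (hX s h')
  by_cases hm : p m ∈ points X
  · obtain ⟨i, hi⟩ := hm
    have hi' : p m = ((p m).1, X (p m).1 i) := Prod.ext rfl hi.symm
    rw [Fintype.prod_eq_single ((p m).1, i), if_pos hi', if_pos ⟨i, hi⟩, mul_one]
    intro b hb
    rw [if_neg fun hb' => hb (huniq b _ hb' hi'), add_zero]
  · rw [if_neg hm, mul_zero, add_zero]
    refine Finset.prod_eq_one fun b _ => ?_
    rw [if_neg, add_zero]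
    intro hb
    exact hm ⟨b.2, by rw [hb]⟩

/-- The inclusion–exclusion formula that matches `sum_det_one_add_diagonal_mul`. -/
theorem prod_eq_sum_prod_one_add {ι : Type*} [Fintype ι] [DecidableEq ι] (c : ι → ℂ) :
    ∏ m, c m = ∑ S : Finset ι, (∏ _i ∈ Finset.univ \ S, (-1 : ℂ)) *
      ∏ m, (1 + (if m ∈ S then 1 else 0) * c m) := by
  have h := Finset.prod_add (fun m => 1 + c m) (fun _ => (-1 : ℂ)) Finset.univ
  simp only [add_neg_cancel_comm] at h
  rw [h, Finset.powerset_univ]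
  refine Finset.sum_congr rfl fun S _ => ?_
  rw [mul_comm, ← Finset.prod_sdiff (Finset.subset_univ S)
    (f := fun m => (1 + (if m ∈ S then 1 else 0) * c m))]
  congr 1
  rw [Finset.prod_eq_one (s := Finset.univ \ S), one_mul]
  · exact Finset.prod_congr rfl fun _ hi => by rw [if_pos hi, one_mul]
  · intro i hi
    rw [if_neg (Finset.mem_sdiff.1 hi).2, zero_mul, add_zero]

variable {α β k l p}

theorem hasSum_configs (hα : ∀ j, ‖α j‖ < 1) (hβ : ∀ j, ‖β j‖ < 1) (hk : StrictMono k)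
    (hl : StrictMono l) :
    HasSum (fun X : configs k l => weight α β X.1) (gramMatrix α β k l).det := by
  -- Without weighted points, the path sums are the propagators themselves.
  have h := hasSum_configs_siteWeight hα hβ hk hl (fun e : Empty => e.elim) (fun e => e.elim)
  rw [siteWeight_mul_pathSum_zero] at h
  have h0 : ∀ (A : Matrix (Fin N) Empty ℂ) (B : Matrix Empty (Fin N) ℂ), A * B = 0 := by
    intro A B
    ext i j
    simp [Matrix.mul_apply]
  rw [h0, add_zero] at h
  simpa [siteWeight] using h

theorem partitionFunction_eq (hα : ∀ j, ‖α j‖ < 1) (hβ : ∀ j, ‖β j‖ < 1) (hk : StrictMono k)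
    (hl : StrictMono l) : partitionFunction k l α β = (gramMatrix α β k l).det :=
  (hasSum_configs hα hβ hk hl).tsum_eq

open Classical in
theorem hasSum_configs_points (hα : ∀ j, ‖α j‖ < 1) (hβ : ∀ j, ‖β j‖ < 1) (hk : StrictMono k)
    (hl : StrictMono l) (hp : Function.Injective p) (hG : (gramMatrix α β k l).det ≠ 0) :
    HasSum (fun X : configs k l => weight α β X.1 * ∏ m, if p m ∈ points X.1 then 1 else 0)
      ((gramMatrix α β k l).det * (correlationMatrix α β k l p).det) := by
  have h := hasSum_sum (s := Finset.univ) fun (S : Finset ι) _ =>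
    (hasSum_configs_siteWeight hα hβ hk hl p fun i => if i ∈ S then 1 else 0).mul_left
      (∏ _i ∈ Finset.univ \ S, (-1 : ℂ))
  simp_rw [det_weighted α β k l p _ hG, mul_left_comm _ (gramMatrix α β k l).det] at h
  rw [← Finset.mul_sum, sum_det_one_add_diagonal_mul] at h
  refine hasSum_of_forall_eq h fun X => ?_
  rw [prod_eq_sum_prod_one_add, Finset.mul_sum]
  refine Finset.sum_congr rfl fun S _ => ?_
  rw [prod_siteWeight hp _ fun s => (strictMono_of_mem_configs hk X.2 s).injective]
  ring

theorem correlation_eq {n : ℕ} {p : Fin n → Fin (2 * N + 1) × ℤ} (hα : ∀ j, ‖α j‖ < 1)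
    (hβ : ∀ j, ‖β j‖ < 1) (hk : StrictMono k) (hl : StrictMono l) (hp : Function.Injective p)
    (hG : (gramMatrix α β k l).det ≠ 0) :
    correlation k l α β p = (correlationMatrix α β k l p).det := by
  classical
  have h := (hasSum_configs_points hα hβ hk hl hp hG).tsum_eq
  rw [correlation, partitionFunction_eq hα hβ hk hl, div_eq_iff hG,
    mul_comm (correlationMatrix α β k l p).det, ← h]
  rw [tsum_subtype (configs k l)
    (fun X => weight α β X * ∏ m, if p m ∈ points X then (1 : ℂ) else 0)]
  have h2 := tsum_subtype {X : PathTuple N | X ∈ configs k l ∧ ∀ m, p m ∈ points X} (weight α β)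
  refine h2.trans (tsum_congr fun X => ?_)
  by_cases hX : X ∈ configs k l
  · rw [Set.indicator_of_mem hX]
    by_cases hm : ∀ m, p m ∈ points X
    · have hmem : X ∈ {X : PathTuple N | X ∈ configs k l ∧ ∀ m, p m ∈ points X} := ⟨hX, hm⟩
      rw [Set.indicator_of_mem hmem]
      simp [hm]
    · rw [Set.indicator_of_notMem fun h => hm h.2]
      push Not at hm
      obtain ⟨m, hm⟩ := hm
      rw [Finset.prod_eq_zero (Finset.mem_univ m) (if_neg hm), mul_zero]
  · rw [Set.indicator_of_notMem hX, Set.indicator_of_notMem fun h => hX h.1]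

end Determinant

/-! ### Residues -/

section Residues

variable {N : ℕ}

/-- The steps are the `N` steps upwards, followed by the `N` steps downwards in reversed order. -/
theorem prod_steps {M : Type*} [CommMonoid M] (f : Fin (2 * N) → M) :
    ∏ n, f n = (∏ i : Fin N, f ⟨i, by omega⟩) * ∏ i : Fin N, f ⟨2 * N - 1 - i, by omega⟩ := by
  rw [← (finCongr (two_mul N).symm).prod_comp, Fin.prod_univ_add, ← Equiv.prod_comp Fin.revPerm
    (fun i : Fin N => f (finCongr (two_mul N).symm (Fin.natAdd N i)))]
  congr 1
  refine Finset.prod_congr rfl fun i _ => congrArg f ?_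
  ext
  simp only [finCongr_apply, Fin.revPerm_apply, Fin.val_cast, Fin.val_natAdd, Fin.val_rev]
  omega

variable (α β : Fin N → ℂ)

theorem stepGen_up (i : Fin N) (z : ℂ) :
    stepGen α β ⟨i, by omega⟩ z = (1 - α i * z)⁻¹ := by
  simp [stepGen, stepParam]

theorem stepGen_down (i : Fin N) (z : ℂ) :
    stepGen α β ⟨2 * N - 1 - i, by omega⟩ z = (1 - β i / z)⁻¹ := by
  have h : ¬ 2 * N - 1 - i.val < N := by omega
  have h2 : 2 * N - 1 - (2 * N - 1 - i.val) = i.val := by omega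
  simp [stepGen, stepParam, h, h2]

theorem symbol_of_le {s t : ℕ} (ht : t ≤ N) (z : ℂ) :
    symbol α β s t z = ∏ n : Fin N with s ≤ n.val ∧ n.val < t, (1 - α n * z)⁻¹ := by
  rw [symbol, Finset.prod_filter, prod_steps, Finset.prod_filter, Finset.prod_eq_one
    (f := fun i : Fin N => if s ≤ 2 * N - 1 - i.val ∧ 2 * N - 1 - i.val < t then _ else _), mul_one]
  · simp only [stepGen_up]
  · exact fun i _ => if_neg (by omega)

theorem symbol_to_end {s : ℕ} (hs : s ≤ N) (z : ℂ) :
    symbol α β s (2 * N) z =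
      (∏ n : Fin N with s ≤ n.val, (1 - α n * z)⁻¹) * ∏ r, (1 - β r / z)⁻¹ := by
  rw [symbol, Finset.prod_filter, prod_steps, Finset.prod_filter]
  congr 1
  · refine Finset.prod_congr rfl fun i _ => ?_
    have : i.val < 2 * N := by omega
    simp only [stepGen_up, this, and_true]
  · refine Finset.prod_congr rfl fun i _ => ?_
    have : s ≤ 2 * N - 1 - i.val ∧ 2 * N - 1 - i.val < 2 * N := by omega
    rw [if_pos this, stepGen_down]

/-- The partial fraction decomposition of the reciprocal of a polynomial with simple roots. -/
theorem prod_inv_sub_eq_sum {β : Fin N → ℂ} (hN : 0 < N) (hβ : Function.Injective β) {z : ℂ}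
    (hz : ∀ r, z ≠ β r) :
    ∏ r, (z - β r)⁻¹ = ∑ r, (∏ q ∈ Finset.univ.erase r, (β r - β q)⁻¹) * (z - β r)⁻¹ := by
  have hne : (Finset.univ : Finset (Fin N)).Nonempty := ⟨⟨0, hN⟩, Finset.mem_univ _⟩
  have h := Lagrange.eval_interpolate_not_at_node (s := Finset.univ) (v := β) 1
    (x := z) fun r _ => hz r
  rw [Lagrange.interpolate_one hβ.injOn hne, Polynomial.eval_one, Lagrange.eval_nodal] at h
  simp only [Pi.one_apply, mul_one, Lagrange.nodalWeight] at h
  rw [Finset.prod_inv_distrib]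
  exact inv_eq_of_mul_eq_one_right h.symm

/-- Cauchy's integral formula for the normalized contour integral. -/
theorem contour_cauchy {f : ℂ → ℂ} (hf : DifferentiableOn ℂ f (Metric.closedBall 0 1)) {w : ℂ}
    (hw : ‖w‖ < 1) : contour (fun z => (z - w)⁻¹ * f z) = f w := by
  have h := DiffContOnCl.two_pi_i_inv_smul_circleIntegral_sub_inv_smul (c := 0) (R := 1) (f := f)
    (w := w) (DifferentiableOn.diffContOnCl (by rwa [closure_ball _ one_ne_zero])) (by simpa using hw)
  simpa [contour] using h

/-- The residue sum for the propagator to the last line. The condition on `x` excludes a pole at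
the origin. -/
theorem propagator_to_end {α β : Fin N → ℂ} (hN : 0 < N) (hα : ∀ j, ‖α j‖ < 1)
    (hβ : ∀ j, ‖β j‖ < 1) (hβ0 : ∀ j, β j ≠ 0) (hinj : Function.Injective β) {s : ℕ} (hs : s ≤ N)
    {x : ℤ} (hx : x ≤ (N : ℤ) - 1) :
    propagator α β s (2 * N) x = ∑ r, (∏ n : Fin N with s ≤ n.val, (1 - α n * β r)⁻¹) *
      (∏ q ∈ Finset.univ.erase r, (1 - β q / β r)⁻¹) / β r ^ x := by
  obtain ⟨m, hm⟩ := Int.eq_ofNat_of_zero_le (sub_nonneg.2 hx)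
  set P : ℂ → ℂ := fun z => (∏ n : Fin N with s ≤ n.val, (1 - α n * z)⁻¹) * z ^ m with hP
  have hPd : DifferentiableOn ℂ P (Metric.closedBall 0 1) := by
    refine DifferentiableOn.mul ?_ (by fun_prop)
    refine DifferentiableOn.fun_finsetProd fun n _ => DifferentiableOn.inv (by fun_prop) ?_
    exact fun z hz => one_sub_mul_ne_zero (hα n) (by simpa using hz)
  have hne : ∀ {z : ℂ}, ‖z‖ = 1 → ∀ r, z ≠ β r := by
    rintro z hz r rfl
    exact (hβ r).ne hz
  have h1 : propagator α β s (2 * N) x = contour fun z => ∑ r,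
      (∏ q ∈ Finset.univ.erase r, (β r - β q)⁻¹) * ((z - β r)⁻¹ * P z) := by
    refine contour_congr fun z hz => ?_
    have hz0 := ne_zero_of_norm_eq_one hz
    -- The power `z ^ N` cancels the pole of `1 / z ^ (x + 1)` at the origin.
    have h2 : ∏ r, (1 - β r / z)⁻¹ = z ^ N * ∏ r, (z - β r)⁻¹ := by
      have : z ^ N = ∏ _r : Fin N, z := by simp
      rw [this, ← Finset.prod_mul_distrib]
      refine Finset.prod_congr rfl fun r _ => ?_
      rw [← div_eq_mul_inv, ← inv_div _ z, sub_div, div_self hz0]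
    have h3 : z ^ N = z ^ m * z ^ (x + 1) := by
      rw [← zpow_natCast, ← zpow_natCast, ← zpow_add₀ hz0]
      congr 1
      change _ = (m : ℤ) at hm
      omega
    rw [symbol_to_end α β hs, h2, prod_inv_sub_eq_sum hN hinj (hne hz), h3, hP]
    have h4 : z ^ (x + 1) ≠ 0 := zpow_ne_zero _ hz0
    rw [div_eq_iff h4, Finset.mul_sum, Finset.mul_sum, Finset.sum_mul]
    refine Finset.sum_congr rfl fun r _ => ?_
    ring
  rw [h1, contour_sum]
  · refine Finset.sum_congr rfl fun r _ => ?_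
    rw [contour_const_mul, contour_cauchy hPd (hβ r), hP]
    have h5 : ∏ q ∈ Finset.univ.erase r, (1 - β q / β r)⁻¹ =
        β r ^ (N - 1) * ∏ q ∈ Finset.univ.erase r, (β r - β q)⁻¹ := by
      have : β r ^ (N - 1) = ∏ _q ∈ Finset.univ.erase r, β r := by simp
      rw [this, ← Finset.prod_mul_distrib]
      refine Finset.prod_congr rfl fun q _ => ?_
      rw [← div_eq_mul_inv, ← inv_div _ (β r), sub_div, div_self (hβ0 r)]
    have h6 : β r ^ (N - 1) = β r ^ m * β r ^ x := by
      rw [← zpow_natCast, ← zpow_natCast, ← zpow_add₀ (hβ0 r)]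
      congr 1
      change _ = (m : ℤ) at hm
      omega
    have h7 : β r ^ x ≠ 0 := zpow_ne_zero _ (hβ0 r)
    rw [h5, h6, eq_div_iff h7]
    ring
  · intro r _
    refine continuousOn_const.mul (ContinuousOn.mul (ContinuousOn.inv₀ (by fun_prop) fun z hz =>
      sub_ne_zero.2 (hne hz r)) (hPd.continuousOn.mono fun z hz => ?_))
    simpa using (show ‖z‖ = 1 from hz).le

end Residues

/-! ### The kernel -/

section Kernel

variable {N : ℕ}

/-- The matrix whose determinant is `alternant k γ`. -/
noncomputable def alternantMatrix (k : Fin N → ℤ) (γ : Fin N → ℂ) : Matrix (Fin N) (Fin N) ℂ :=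
  Matrix.of fun i j => γ j ^ k i

theorem alternant_update (k : Fin N → ℤ) (γ : Fin N → ℂ) (j : Fin N) (z : ℂ) :
    alternant k (Function.update γ j z) =
      ∑ i, (alternantMatrix k γ).adjugate j i * z ^ k i := by
  have h : (Matrix.of fun i r => Function.update γ j z r ^ k i) =
      (alternantMatrix k γ).updateCol j fun i => z ^ k i := by
    ext i r
    rw [Matrix.updateCol_apply, Matrix.of_apply, Function.update_apply]
    split_ifs <;> rfl
  rw [alternant, h, ← Matrix.cramer_apply, Matrix.cramer_eq_adjugate_mulVec]
  rfl

/-- The residue at `β r` of the generating function of a walker on all lines, without the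
power of `z`. -/
noncomputable def residueWeight (α β : Fin N → ℂ) (r : Fin N) : ℂ :=
  (∏ n, (1 - α n * β r)⁻¹) * ∏ q ∈ Finset.univ.erase r, (1 - β q / β r)⁻¹

theorem residueWeight_ne_zero {α β : Fin N → ℂ} (hα : ∀ j, ‖α j‖ < 1) (hβ : ∀ j, ‖β j‖ < 1)
    (hβ0 : ∀ j, β j ≠ 0) (hinj : Function.Injective β) (r : Fin N) :
    residueWeight α β r ≠ 0 := by
  refine mul_ne_zero (Finset.prod_ne_zero_iff.2 fun n _ => inv_ne_zero
    (one_sub_mul_ne_zero (hα n) (hβ r).le)) (Finset.prod_ne_zero_iff.2 fun q hq => inv_ne_zero ?_)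
  rw [sub_ne_zero, ne_comm, ne_eq, div_eq_one_iff_eq (hβ0 r)]
  exact hinj.ne (Finset.mem_erase.1 hq).1

variable {α β : Fin N → ℂ} {k l : Fin N → ℤ}

/-- The residue sums factor the Gram matrix through the two alternants. -/
theorem gramMatrix_eq (hN : 0 < N) (hα : ∀ j, ‖α j‖ < 1) (hβ : ∀ j, ‖β j‖ < 1)
    (hβ0 : ∀ j, β j ≠ 0) (hinj : Function.Injective β) (hk : ∀ i, 0 ≤ k i)
    (hl : ∀ j, l j ≤ (N : ℤ) - 1) :
    gramMatrix α β k l = alternantMatrix k β * Matrix.diagonal (residueWeight α β) *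
      (alternantMatrix l fun i => 1 / β i).transpose := by
  ext i j
  rw [gramMatrix, Matrix.of_apply, propagator_to_end hN hα hβ hβ0 hinj (Nat.zero_le N)
    (by have := hk i; have := hl j; omega), Matrix.mul_apply]
  refine Finset.sum_congr rfl fun r _ => ?_
  rw [Matrix.mul_diagonal, Matrix.transpose_apply, alternantMatrix, alternantMatrix,
    Matrix.of_apply, Matrix.of_apply, zpow_sub₀ (hβ0 r), one_div, inv_zpow, residueWeight]
  simp only [Nat.zero_le, Finset.filter_true]
  rw [div_div_eq_mul_div, div_eq_mul_inv]
  ring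

theorem alternant_ne_zero_of_det_gramMatrix (hN : 0 < N) (hα : ∀ j, ‖α j‖ < 1)
    (hβ : ∀ j, ‖β j‖ < 1) (hβ0 : ∀ j, β j ≠ 0) (hinj : Function.Injective β)
    (hk : ∀ i, 0 ≤ k i) (hl : ∀ j, l j ≤ (N : ℤ) - 1) (hG : (gramMatrix α β k l).det ≠ 0) :
    alternant k β ≠ 0 ∧ alternant l (fun i => 1 / β i) ≠ 0 := by
  rw [gramMatrix_eq hN hα hβ hβ0 hinj hk hl, Matrix.det_mul, Matrix.det_mul,
    Matrix.det_transpose] at hG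
  exact ⟨left_ne_zero_of_mul (left_ne_zero_of_mul hG), right_ne_zero_of_mul hG⟩

theorem gramMatrix_inv (hN : 0 < N) (hα : ∀ j, ‖α j‖ < 1) (hβ : ∀ j, ‖β j‖ < 1)
    (hβ0 : ∀ j, β j ≠ 0) (hinj : Function.Injective β) (hk : ∀ i, 0 ≤ k i)
    (hl : ∀ j, l j ≤ (N : ℤ) - 1) (hG : (gramMatrix α β k l).det ≠ 0) :
    (gramMatrix α β k l)⁻¹ = (alternant k β * alternant l fun i => 1 / β i)⁻¹ •
      ((alternantMatrix l fun i => 1 / β i).adjugate.transpose *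
        Matrix.diagonal (fun r => (residueWeight α β r)⁻¹) * (alternantMatrix k β).adjugate) := by
  obtain ⟨h1, h2⟩ := alternant_ne_zero_of_det_gramMatrix hN hα hβ hβ0 hinj hk hl hG
  refine Matrix.inv_eq_left_inv ?_
  rw [gramMatrix_eq hN hα hβ hβ0 hinj hk hl]
  set A := alternantMatrix k β with hA
  set A' := alternantMatrix l fun i => 1 / β i with hA'
  have hA1 : A.adjugate * A = alternant k β • 1 := Matrix.adjugate_mul A
  have hA2 : A'.adjugate.transpose * A'.transpose = (alternant l fun i => 1 / β i) • 1 := by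
    rw [← Matrix.transpose_mul, Matrix.mul_adjugate, Matrix.transpose_smul, Matrix.transpose_one]
    rfl
  have hD : Matrix.diagonal (fun r => (residueWeight α β r)⁻¹) *
      Matrix.diagonal (residueWeight α β) = 1 := by
    rw [Matrix.diagonal_mul_diagonal, ← Matrix.diagonal_one]
    congr 1
    funext r
    exact inv_mul_cancel₀ (residueWeight_ne_zero hα hβ hβ0 hinj r)
  calc (alternant k β * alternant l fun i => 1 / β i)⁻¹ •
      (A'.adjugate.transpose * Matrix.diagonal (fun r => (residueWeight α β r)⁻¹) * A.adjugate) *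
        (A * Matrix.diagonal (residueWeight α β) * A'.transpose)
      = (alternant k β * alternant l fun i => 1 / β i)⁻¹ • (A'.adjugate.transpose *
        (Matrix.diagonal (fun r => (residueWeight α β r)⁻¹) * (A.adjugate * A) *
          Matrix.diagonal (residueWeight α β)) * A'.transpose) := by
        simp only [Matrix.smul_mul, Matrix.mul_assoc]
    _ = 1 := by
        rw [hA1, Matrix.mul_smul, Matrix.mul_one, Matrix.smul_mul, hD, Matrix.mul_smul,
          Matrix.smul_mul, Matrix.mul_one, hA2, smul_smul, smul_smul, mul_assoc,
          inv_mul_cancel₀ (mul_ne_zero h1 h2), one_smul]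

theorem continuousOn_symbol_mul (hα : ∀ j, ‖α j‖ < 1) (hβ : ∀ j, ‖β j‖ < 1)
    (s t : ℕ) (x : ℤ) (c : ℂ) :
    ContinuousOn (fun z => c * (symbol α β s t z / z ^ x)) {z | ‖z‖ = 1} :=
  continuousOn_const.mul (continuousOn_div_zpow_circle (continuousOn_symbol hα hβ s t) x)

theorem contour_alternant_left (hα : ∀ j, ‖α j‖ < 1) (hβ : ∀ j, ‖β j‖ < 1) (k : Fin N → ℤ)
    (j : Fin N) (s : ℕ) (x : ℤ) :
    contour (fun z => alternant k (Function.update β j z) *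
        (∏ n : Fin (2 * N) with n.val < s, stepGen α β n z) / z ^ (x + 1)) =
      ∑ i, (alternantMatrix k β).adjugate j i * propagator α β 0 s (x - k i) := by
  simp_rw [propagator, ← contour_const_mul]
  rw [← contour_sum]
  on_goal 2 => exact fun i _ => continuousOn_symbol_mul hα hβ _ _ _ _
  refine contour_congr fun z hz => ?_
  have hz0 := ne_zero_of_norm_eq_one hz
  simp only [alternant_update, symbol, Nat.zero_le, true_and]
  rw [Finset.sum_mul, Finset.sum_div]
  refine Finset.sum_congr rfl fun i _ => ?_
  rw [show x - k i + 1 = (x + 1) - k i by ring, zpow_sub₀ hz0]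
  have := zpow_ne_zero (k i) hz0
  field_simp

theorem contour_alternant_right (hα : ∀ j, ‖α j‖ < 1) (hβ : ∀ j, ‖β j‖ < 1) (l : Fin N → ℤ)
    (j : Fin N) (s : ℕ) (x : ℤ) :
    contour (fun z => alternant l (Function.update (fun i => 1 / β i) j (1 / z)) *
        (∏ n : Fin (2 * N) with s ≤ n.val, stepGen α β n z) * (z ^ x / z)) =
      ∑ i, (alternantMatrix l fun i => 1 / β i).adjugate j i *
        propagator α β s (2 * N) (l i - x) := by
  simp_rw [propagator, ← contour_const_mul]
  rw [← contour_sum]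
  on_goal 2 => exact fun i _ => continuousOn_symbol_mul hα hβ _ _ _ _
  refine contour_congr fun z hz => ?_
  have hz0 := ne_zero_of_norm_eq_one hz
  simp only [alternant_update, symbol, Fin.is_lt, and_true]
  rw [Finset.sum_mul, Finset.sum_mul]
  refine Finset.sum_congr rfl fun i _ => ?_
  rw [one_div, inv_zpow, zpow_add₀ hz0, zpow_sub₀ hz0, zpow_one]
  have := zpow_ne_zero (l i) hz0
  have := zpow_ne_zero x hz0
  field_simp

theorem residueWeight_inv (r : Fin N) : (residueWeight α β r)⁻¹ =
    (∏ n, (1 - α n * β r)) * ∏ q ∈ Finset.univ.erase r, (1 - β q / β r) := by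
  simp [residueWeight, Finset.prod_inv_distrib, mul_comm]

theorem correlationMatrix_apply {ι : Type*} (hN : 0 < N)
    (hα : ∀ j, ‖α j‖ < 1) (hβ : ∀ j, ‖β j‖ < 1) (hβ0 : ∀ j, β j ≠ 0)
    (hinj : Function.Injective β) (hk : ∀ i, 0 ≤ k i) (hl : ∀ j, l j ≤ (N : ℤ) - 1)
    (hG : (gramMatrix α β k l).det ≠ 0) (p : ι → Fin (2 * N + 1) × ℤ) (m m' : ι) :
    correlationMatrix α β k l p m m' =
      kernel k l α β (p m').1 (p m').2 (p m).1 (p m).2 := by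
  rw [correlationMatrix, gramMatrix_inv hN hα hβ hβ0 hinj hk hl hG, Matrix.sub_apply, kernel,
    sub_eq_neg_add]
  congr 1
  simp_rw [contour_alternant_left hα hβ, contour_alternant_right hα hβ]
  rw [Matrix.mul_smul, Matrix.smul_mul, Matrix.smul_apply]
  simp only [← Matrix.mul_assoc]
  rw [Matrix.mul_assoc (_ * Matrix.diagonal _), Matrix.mul_apply, Finset.smul_sum]
  refine Finset.sum_congr rfl fun r _ => ?_
  rw [Matrix.mul_diagonal, Matrix.mul_apply, Matrix.mul_apply, residueWeight_inv, smul_eq_mul]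
  simp only [rightMatrix, leftMatrix, Matrix.transpose_apply, Matrix.of_apply]
  simp_rw [mul_comm (propagator α β (p m).1 (2 * N) _)]
  ring

theorem det_correlationMatrix {ι : Type*} [Fintype ι] [DecidableEq ι] (hN : 0 < N)
    (hα : ∀ j, ‖α j‖ < 1) (hβ : ∀ j, ‖β j‖ < 1) (hβ0 : ∀ j, β j ≠ 0)
    (hinj : Function.Injective β) (hk : ∀ i, 0 ≤ k i) (hl : ∀ j, l j ≤ (N : ℤ) - 1)
    (hG : (gramMatrix α β k l).det ≠ 0) (p : ι → Fin (2 * N + 1) × ℤ) :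
    (correlationMatrix α β k l p).det =
      (Matrix.of fun i j => kernel k l α β (p i).1 (p i).2 (p j).1 (p j).2).det := by
  rw [← Matrix.det_transpose]
  congr 1
  ext i j
  exact correlationMatrix_apply hN hα hβ hβ0 hinj hk hl hG p j i

/-- On the left half, the integral against `alternant l` is a sum of residues at the `β r`, and
only the one at `β j` does not produce a repeated column. -/
theorem kernel_eq_leftKernel (hN : 0 < N)
    (hα : ∀ j, ‖α j‖ < 1) (hβ : ∀ j, ‖β j‖ < 1) (hβ0 : ∀ j, β j ≠ 0)
    (hinj : Function.Injective β) (hl : ∀ j, l j ≤ (N : ℤ) - 1)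
    (hl0 : alternant l (fun i => 1 / β i) ≠ 0) {s₁ s₂ : ℕ} (hs₁ : s₁ ≤ N) (hs₂ : s₂ ≤ N) (x₁ : ℤ)
    {x₂ : ℤ} (hx₂ : 0 ≤ x₂) :
    kernel k l α β s₁ x₁ s₂ x₂ = leftKernel k α β s₁ x₁ s₂ x₂ := by
  have hsym : ∀ s z, (∏ n : Fin (2 * N) with s ≤ n.val ∧ n.val < s₁, stepGen α β n z) =
    ∏ n : Fin N with s ≤ n.val ∧ n.val < s₁, (1 - α n * z)⁻¹ := fun s z => symbol_of_le α β hs₁ z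
  rw [kernel, leftKernel]
  congr 1
  · simp_rw [hsym]
  refine Finset.sum_congr rfl fun j _ => ?_
  set A := alternantMatrix l fun i => 1 / β i with hA
  have h1 : contour (fun z => alternant l (Function.update (fun i => 1 / β i) j (1 / z)) *
        (∏ n : Fin (2 * N) with s₂ ≤ n.val, stepGen α β n z) * (z ^ x₂ / z)) =
      (alternant l fun i => 1 / β i) * ((∏ n : Fin N with s₂ ≤ n.val, (1 - α n * β j)⁻¹) *
      (∏ q ∈ Finset.univ.erase j, (1 - β q / β j)⁻¹) * β j ^ x₂) := by
    rw [contour_alternant_right hα hβ]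
    set R : Fin N → ℂ := fun r => (∏ n : Fin N with s₂ ≤ n.val, (1 - α n * β r)⁻¹) *
      (∏ q ∈ Finset.univ.erase r, (1 - β q / β r)⁻¹) * β r ^ x₂ with hR
    have h2 : ∀ i, propagator α β s₂ (2 * N) (l i - x₂) = ∑ r, A i r * R r := by
      intro i
      rw [propagator_to_end hN hα hβ hβ0 hinj hs₂ (by have := hl i; omega)]
      refine Finset.sum_congr rfl fun r _ => ?_
      rw [hA, alternantMatrix, Matrix.of_apply, zpow_sub₀ (hβ0 r), one_div, inv_zpow, hR,
        div_div_eq_mul_div, div_eq_mul_inv]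
      ring
    have h3 : A.adjugate.mulVec (A.mulVec R) j = (alternant l fun i => 1 / β i) * R j := by
      rw [Matrix.mulVec_mulVec, Matrix.adjugate_mul, Matrix.smul_mulVec, Matrix.one_mulVec]
      rfl
    simp_rw [h2]
    exact h3
  have hsym0 : ∀ z, (∏ n : Fin (2 * N) with n.val < s₁, stepGen α β n z) =
      ∏ n : Fin N with n.val < s₁, (1 - α n * z)⁻¹ := by
    intro z
    simpa only [Nat.zero_le, true_and] using hsym 0 z
  have h4 : (∏ r, (1 - α r * β j)) * (∏ n : Fin N with s₂ ≤ n.val, (1 - α n * β j)⁻¹) =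
      ∏ r : Fin N with r.val < s₂, (1 - α r * β j) := by
    rw [← Finset.prod_filter_mul_prod_filter_not Finset.univ fun r : Fin N => r.val < s₂]
    simp only [not_lt]
    rw [mul_assoc, ← Finset.prod_mul_distrib, Finset.prod_congr rfl
      fun r _ => mul_inv_cancel₀ (one_sub_mul_ne_zero (hα r) (hβ j).le), Finset.prod_const_one,
      mul_one]
  have h5 : (∏ q ∈ Finset.univ.erase j, (1 - β q / β j)) *
      (∏ q ∈ Finset.univ.erase j, (1 - β q / β j)⁻¹) = 1 := by
    have h := residueWeight_ne_zero hα hβ hβ0 hinj j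
    rw [residueWeight, Finset.prod_inv_distrib (s := Finset.univ.erase j)] at h
    rw [Finset.prod_inv_distrib]
    exact mul_inv_cancel₀ fun h0 => right_ne_zero_of_mul h (by rw [h0, inv_zero])
  have h6 : contour (fun z => alternant k (Function.update β j z) / alternant k β *
        (∏ r : Fin N with r.val < s₂, (1 - α r * β j)) * β j ^ x₂ *
        (∏ n : Fin N with n.val < s₁, (1 - α n * z)⁻¹) / z ^ (x₁ + 1)) =
      (alternant k β)⁻¹ * (∏ r : Fin N with r.val < s₂, (1 - α r * β j)) * β j ^ x₂ *
      contour (fun z => alternant k (Function.update β j z) *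
        (∏ n : Fin (2 * N) with n.val < s₁, stepGen α β n z) / z ^ (x₁ + 1)) := by
    rw [← contour_const_mul]
    refine contour_congr fun z _ => ?_
    rw [hsym0]
    ring
  rw [h1, h6, ← h4, div_eq_mul_inv, mul_inv]
  linear_combination (alternant k β)⁻¹ * β j ^ x₂ *
    (contour fun z => alternant k (Function.update β j z) *
        (∏ n : Fin (2 * N) with n.val < s₁, stepGen α β n z) / z ^ (x₁ + 1)) *
    ((∏ r, (1 - α r * β j)) * ∏ n : Fin N with s₂ ≤ n.val, (1 - α n * β j)⁻¹) *
    ((alternant l fun i => 1 / β i)⁻¹ * (alternant l fun i => 1 / β i) * h5 +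
      inv_mul_cancel₀ hl0)

end Kernel

/-! ### Nonnegative weights -/

section Positive

variable {N : ℕ} {k l : Fin N → ℤ}

theorem add_le_of_strictMono (hk : StrictMono k) (d : ℕ) {i j : Fin N} (h : j.val = i.val + d) :
    k i + d ≤ k j := by
  induction d generalizing j with
  | zero =>
    have : i = j := Fin.ext (by omega)
    simp [this]
  | succ d ih =>
    have h1 := ih (j := ⟨i.val + d, by omega⟩) rfl
    have h2 : k ⟨i.val + d, by omega⟩ < k j := hk (Fin.lt_def.2 (by simp only; omega))
    push_cast
    omega

/-- If all end points lie below the starting points, there is an admissible family in which they stay put in the first `N`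
steps and then jump from `k i` to `l i` one after the other, starting with the lowest. -/
theorem exists_mem_configs_weight_pos (hk : StrictMono k) (hl : StrictMono l)
    (hlk : ∀ i, l i ≤ k i) {a b : Fin N → ℝ} (hb : ∀ j, 0 < b j) :
    ∃ X ∈ configs k l, 0 < weight a b X := by
  let X : PathTuple N := fun s i => if s.val ≤ N + i.val then k i else l i
  have hup : ∀ (n : Fin (2 * N)) i, n.val < N → X n.succ i = X n.castSucc i := by
    intro n i hn
    simp only [X, Fin.val_succ, Fin.val_castSucc]
    rw [if_pos (by omega), if_pos (by omega)]
  refine ⟨X, mem_configs_iff.2 ⟨?_, ?_, fun n => ⟨fun i => ?_, fun i j hij => ?_⟩⟩, ?_⟩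
  · funext i
    simp [X]
  · funext i
    have : ¬ 2 * N ≤ N + i.val := by omega
    simp [X, this]
  · split_ifs with hn
    · exact (hup n i hn).ge
    · have := hlk i
      simp only [X, Fin.val_succ, Fin.val_castSucc]
      split_ifs <;> omega
  · rw [disjoint_uIcc_iff]
    have hki := hlk i
    have hkj := hlk j
    simp only [X, Fin.val_succ, Fin.val_castSucc]
    rcases lt_or_gt_of_ne hij with h | h
    · have := hk h
      have := hl h
      rw [Fin.lt_def] at h
      split_ifs <;> omega
    · have := hk h
      have := hl h
      rw [Fin.lt_def] at h
      split_ifs <;> omega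
  · refine Finset.prod_pos fun n _ => Finset.prod_pos fun i _ => ?_
    by_cases hn : n.val < N
    · rw [hup n i hn]
      simp
    · rw [stepParam, dif_neg hn]
      exact pow_pos (hb _) _

variable {a b : Fin N → ℝ}

theorem stepParam_nonneg (ha : ∀ j, 0 ≤ a j) (hb : ∀ j, 0 < b j) (n : Fin (2 * N)) :
    0 ≤ stepParam a b n := by
  unfold stepParam
  split_ifs
  · exact ha _
  · exact (hb _).le

theorem weight_nonneg (ha : ∀ j, 0 ≤ a j) (hb : ∀ j, 0 < b j) (X : PathTuple N) :
    0 ≤ weight a b X :=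
  Finset.prod_nonneg fun n _ => Finset.prod_nonneg fun _ _ =>
    pow_nonneg (stepParam_nonneg ha hb n) _

theorem weight_ofReal (a b : Fin N → ℝ) (X : PathTuple N) :
    weight (fun j => (a j : ℂ)) (fun j => (b j : ℂ)) X = ((weight a b X : ℝ) : ℂ) := by
  have h : ∀ n : Fin (2 * N), stepParam (fun j => (a j : ℂ)) (fun j => (b j : ℂ)) n =
      ((stepParam a b n : ℝ) : ℂ) := by
    intro n
    unfold stepParam
    split_ifs <;> rfl
  simp [weight, h]

theorem measurableSet_pathTuple (A : Set (PathTuple N)) : MeasurableSet A := by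
  have : Countable (PathTuple N) := inferInstanceAs (Countable (Fin (2 * N + 1) → Fin N → ℤ))
  exact A.to_countable.measurableSet

/-- Walks that intersect contribute nothing, which leaves a sum over `configs`. -/
theorem walkMeasure_apply (ha : ∀ j, 0 ≤ a j) (hb : ∀ j, 0 < b j)
    (hs : Summable fun X : configs k l => weight a b X.1) (A : Set (PathTuple N)) :
    walkMeasure k l a b ({X | Nonintersecting X} ∩ A) =
      ENNReal.ofReal (∑' X : {X : PathTuple N | X ∈ configs k l ∧ X ∈ A}, weight a b X.1) := by
  classical
  have hm : MeasurableSet ({X | Nonintersecting X} ∩ A) := measurableSet_pathTuple _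
  have hsA : Summable fun X : {X : PathTuple N | X ∈ configs k l ∧ X ∈ A} => weight a b X.1 :=
    hs.comp_injective (i := fun X : {X : PathTuple N | X ∈ configs k l ∧ X ∈ A} =>
      (⟨X.1, X.2.1⟩ : configs k l)) fun X Y h => Subtype.ext (congrArg (fun Z => Z.1) h)
  have h0 : ∀ X : {X : PathTuple N | X ∈ configs k l ∧ X ∈ A}, 0 ≤ weight a b X.1 :=
    fun X => weight_nonneg ha hb X.1
  rw [ENNReal.ofReal_tsum_of_nonneg h0 hsA, walkMeasure, Measure.sum_apply _ hm]
  simp only [Measure.smul_apply, smul_eq_mul, Measure.dirac_apply' _ hm]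
  have h1 := tsum_subtype {X : PathTuple N | IsWalk k l X} fun X =>
    ENNReal.ofReal (weight a b X) * ({X | Nonintersecting X} ∩ A).indicator 1 X
  have h2 := tsum_subtype {X : PathTuple N | X ∈ configs k l ∧ X ∈ A} fun X =>
    ENNReal.ofReal (weight a b X)
  refine h1.trans (Eq.trans (tsum_congr fun X => ?_) h2.symm)
  simp only [Set.indicator_apply, configs, Set.mem_ofPred_eq, Set.mem_inter_iff, Pi.one_apply]
  split_ifs <;> simp_all

theorem tsum_weight_ofReal (a b : Fin N → ℝ) (S : Set (PathTuple N)) :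
    ∑' X : S, weight (fun j => (a j : ℂ)) (fun j => (b j : ℂ)) X.1 =
      ((∑' X : S, weight a b X.1 : ℝ) : ℂ) := by
  simp_rw [weight_ofReal]
  exact (Complex.ofReal_tsum _).symm

theorem tsum_weight_pos (ha : ∀ j, 0 ≤ a j) (hb : ∀ j, 0 < b j) (hk : StrictMono k)
    (hl : StrictMono l) (hlk : ∀ i, l i ≤ k i)
    (hs : Summable fun X : configs k l => weight a b X.1) :
    0 < ∑' X : configs k l, weight a b X.1 := by
  obtain ⟨X, hX, hpos⟩ := exists_mem_configs_weight_pos hk hl hlk (a := a) hb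
  exact hs.tsum_pos (fun X => weight_nonneg ha hb X.1) ⟨X, hX⟩ hpos

theorem walkMeasure_nonintersecting (ha : ∀ j, 0 ≤ a j) (hb : ∀ j, 0 < b j)
    (hs : Summable fun X : configs k l => weight a b X.1) :
    walkMeasure k l a b {X | Nonintersecting X} =
      ENNReal.ofReal (∑' X : configs k l, weight a b X.1) := by
  have h := walkMeasure_apply ha hb hs Set.univ
  rw [Set.inter_univ] at h
  have hset : {X : PathTuple N | X ∈ configs k l ∧ X ∈ Set.univ} = configs k l := by
    ext X
    simp
  rw [h]
  exact congrArg (fun S : Set (PathTuple N) => ENNReal.ofReal (∑' X : S, weight a b X.1)) hset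

theorem isProbabilityMeasure_pathLaw (ha : ∀ j, 0 ≤ a j) (hb : ∀ j, 0 < b j) (hk : StrictMono k)
    (hl : StrictMono l) (hlk : ∀ i, l i ≤ k i)
    (hs : Summable fun X : configs k l => weight a b X.1) :
    IsProbabilityMeasure (pathLaw k l a b) := by
  have h := walkMeasure_nonintersecting ha hb hs
  refine ProbabilityTheory.cond_isProbabilityMeasure_of_finite ?_ ?_
  · rw [h]
    exact (ENNReal.ofReal_pos.2 (tsum_weight_pos ha hb hk hl hlk hs)).ne'
  · rw [h]
    exact ENNReal.ofReal_ne_top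

/-- For nonnegative parameters the correlation function is the probability that the paths pass
through the given points. -/
theorem pathLaw_real_eq_correlation (ha : ∀ j, 0 ≤ a j) (hb : ∀ j, 0 < b j)
    (hs : Summable fun X : configs k l => weight a b X.1) {n : ℕ}
    (p : Fin n → Fin (2 * N + 1) × ℤ) :
    (((pathLaw k l a b).real {X | ∀ m, p m ∈ points X} : ℝ) : ℂ) =
      correlation k l (fun j => (a j : ℂ)) (fun j => (b j : ℂ)) p := by
  have hm : MeasurableSet {X : PathTuple N | Nonintersecting X} := measurableSet_pathTuple _
  have h0 : ∀ S : Set (PathTuple N), 0 ≤ ∑' X : S, weight a b X.1 :=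
    fun S => tsum_nonneg fun X => weight_nonneg ha hb X.1
  have h1 := walkMeasure_apply ha hb hs {X | ∀ m, p m ∈ points X}
  rw [correlation, partitionFunction, tsum_weight_ofReal, tsum_weight_ofReal, ← Complex.ofReal_div,
    Measure.real, pathLaw, ProbabilityTheory.cond_apply hm,
    walkMeasure_nonintersecting ha hb hs, h1, ENNReal.toReal_mul, ENNReal.toReal_inv,
    ENNReal.toReal_ofReal (h0 _), ENNReal.toReal_ofReal (h0 _), inv_mul_eq_div]
  rfl

end Positive

end StaircasePaths

theorem mainTheorem1 (N : ℕ) (hN : 0 < N) (k l : Fin N → ℤ)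
    (hk : StrictMono k) (hl : StrictMono l) (hk_first : k ⟨0, hN⟩ = 0)
    (hl_last : l ⟨N - 1, Nat.sub_lt hN Nat.one_pos⟩ ≤ (N : ℤ) - 1) :
    (∀ α β : Fin N → ℂ, (∀ j, ‖α j‖ < 1) → (∀ j, ‖β j‖ < 1) → (∀ j, β j ≠ 0) →
      Function.Injective β →
      Summable (fun X : StaircasePaths.configs k l => ‖StaircasePaths.weight α β X.1‖) ∧
      (StaircasePaths.partitionFunction k l α β ≠ 0 →
        (∀ (n : ℕ) (p : Fin n → Fin (2 * N + 1) × ℤ), Function.Injective p →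
          StaircasePaths.correlation k l α β p =
            (Matrix.of fun i j : Fin n =>
              StaircasePaths.kernel k l α β (p i).1 (p i).2 (p j).1 (p j).2).det) ∧
        (∀ s₁ s₂ x₁ x₂ : ℕ, s₁ ≤ N → s₂ ≤ N →
          StaircasePaths.kernel k l α β s₁ x₁ s₂ x₂ =
            StaircasePaths.leftKernel k α β s₁ x₁ s₂ x₂))) ∧
    (∀ a b : Fin N → ℝ, (∀ j, 0 ≤ a j ∧ a j < 1) → (∀ j, 0 < b j ∧ b j < 1) →
      Function.Injective b →
      StaircasePaths.partitionFunction k l (fun j => (a j : ℂ)) (fun j => (b j : ℂ)) ≠ 0 ∧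
      MeasureTheory.IsProbabilityMeasure (StaircasePaths.pathLaw k l a b) ∧
      ∀ (n : ℕ) (p : Fin n → Fin (2 * N + 1) × ℤ), Function.Injective p →
        (((StaircasePaths.pathLaw k l a b).real
            {X | ∀ m, p m ∈ StaircasePaths.points X} : ℝ) : ℂ) =
          (Matrix.of fun i j : Fin n =>
            StaircasePaths.kernel k l (fun r => (a r : ℂ)) (fun r => (b r : ℂ))
              (p i).1 (p i).2 (p j).1 (p j).2).det) := by
  -- Integrality and the normalization at one end give `l i ≤ i ≤ k i`.
  have hkge : ∀ i : Fin N, (i.val : ℤ) ≤ k i := fun i => by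
    have := StaircasePaths.add_le_of_strictMono hk i.val (i := ⟨0, hN⟩) (j := i) (by simp)
    omega
  have hlle : ∀ i : Fin N, l i ≤ i.val := fun i => by
    have := StaircasePaths.add_le_of_strictMono hl (N - 1 - i.val) (i := i)
      (j := ⟨N - 1, Nat.sub_lt hN Nat.one_pos⟩) (by simp only; omega)
    omega
  have hk0 : ∀ i, 0 ≤ k i := fun i => by
    have := hkge i
    omega
  have hl0 : ∀ j, l j ≤ (N : ℤ) - 1 := fun j => by
    have := hlle j
    omega
  have hcorr : ∀ α β : Fin N → ℂ, (∀ j, ‖α j‖ < 1) → (∀ j, ‖β j‖ < 1) → (∀ j, β j ≠ 0) →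
      Function.Injective β → StaircasePaths.partitionFunction k l α β ≠ 0 →
      ∀ (n : ℕ) (p : Fin n → Fin (2 * N + 1) × ℤ), Function.Injective p →
          StaircasePaths.correlation k l α β p =
            (Matrix.of fun i j : Fin n =>
              StaircasePaths.kernel k l α β (p i).1 (p i).2 (p j).1 (p j).2).det := by
    intro α β hα hβ hβ0 hinj hZ n p hp
    rw [StaircasePaths.partitionFunction_eq hα hβ hk hl] at hZ
    rw [StaircasePaths.correlation_eq hα hβ hk hl hp hZ,
      StaircasePaths.det_correlationMatrix hN hα hβ hβ0 hinj hk0 hl0 hZ]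
  refine ⟨fun α β hα hβ hβ0 hinj => ⟨?_, fun hZ => ⟨hcorr α β hα hβ hβ0 hinj hZ, ?_⟩⟩,
    fun a b ha hb hinj => ?_⟩
  · exact (StaircasePaths.hasSum_configs hα hβ hk hl).summable.norm
  · intro s₁ s₂ x₁ x₂ hs₁ hs₂
    rw [StaircasePaths.partitionFunction_eq hα hβ hk hl] at hZ
    exact StaircasePaths.kernel_eq_leftKernel hN hα hβ hβ0 hinj hl0
      (StaircasePaths.alternant_ne_zero_of_det_gramMatrix hN hα hβ hβ0 hinj hk0 hl0 hZ).2
      hs₁ hs₂ x₁ (Int.natCast_nonneg x₂)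
  · have hα : ∀ j, ‖(a j : ℂ)‖ < 1 := fun j => by
      rw [Complex.norm_real, Real.norm_of_nonneg (ha j).1]
      exact (ha j).2
    have hβ : ∀ j, ‖(b j : ℂ)‖ < 1 := fun j => by
      rw [Complex.norm_real, Real.norm_of_nonneg (hb j).1.le]
      exact (hb j).2
    have ha0 : ∀ j, 0 ≤ a j := fun j => (ha j).1
    have hb0 : ∀ j, 0 < b j := fun j => (hb j).1
    have hlk : ∀ i, l i ≤ k i := fun i => (hlle i).trans (hkge i)
    have hs : Summable fun X : StaircasePaths.configs k l => StaircasePaths.weight a b X.1 := by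
      have h := (StaircasePaths.hasSum_configs hα hβ hk hl).summable
      simp_rw [StaircasePaths.weight_ofReal] at h
      exact Complex.summable_ofReal.1 h
    have hZ : StaircasePaths.partitionFunction k l (fun j => (a j : ℂ)) (fun j => (b j : ℂ)) ≠ 0 := by
      rw [StaircasePaths.partitionFunction, StaircasePaths.tsum_weight_ofReal, Complex.ofReal_ne_zero]
      exact (StaircasePaths.tsum_weight_pos ha0 hb0 hk hl hlk hs).ne'
    refine ⟨hZ, StaircasePaths.isProbabilityMeasure_pathLaw ha0 hb0 hk hl hlk hs, fun n p hp => ?_⟩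
    rw [StaircasePaths.pathLaw_real_eq_correlation ha0 hb0 hs]
    exact hcorr _ _ hα hβ (fun j => Complex.ofReal_ne_zero.2 (hb0 j).ne')
      (Complex.ofReal_injective.comp hinj) hZ n p hp
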